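/- Let $T$ and $M$ be smooth manifolds of dimensions $p\ge 1$ and $n$ with (smooth) Riemannian metrics $h$ and $\varphi$, and let $X$ be a smooth d-tensor field with components $X^{(i)}_{(\alpha)}(t,x)$, i.e. a smooth family of linear maps $X(t,x):T_tT\to T_xM$. On the first-order jet space $J^1(T,M)$, with coordinates $(t^\alpha,x^i,x^i_\alpha)$ induced by arbitrary charts of $T$ and $M$, consider the least squares Lagrangian $$L=h^{\alpha\beta}\varphi_{ij}\,(x^i_\alpha-X^{(i)}_{(\alpha)})(x^j_\beta-X^{(j)}_{(\beta)}).$$ Write $H^\gamma_{\alpha\beta}$, $\gamma^i_{jk}$ for the Christoffel symbols, $H_{\alpha\beta}$, $r_{ij}$ for the Ricci tensors and $H$, $r$ for the scalar curvatures of $h$ and $\varphi$. *Canonical nonlinear connection.* Put $U^{(\alpha)}_{(i)}=-2h^{\alpha\mu}\varphi_{im}X^{(m)}_{(\mu)}$, $\Phi=h^{\mu\nu}\varphi_{rs}X^{(r)}_{(\mu)}X^{(s)}_{(\nu)}$, $U^{(\mu)}_{(l)m}=\partial U^{(\mu)}_{(l)}/\partial x^m-\partial U^{(\mu)}_{(m)}/\partial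 x^l$, $$H^{(i)}_{(\alpha)\beta}=-\tfrac12H^\gamma_{\alpha\beta}x^i_\gamma,\qquad G^{(i)}_{(\alpha)\beta}=\tfrac12\gamma^i_{jk}x^j_\alpha x^k_\beta+\frac{h_{\alpha\beta}\varphi^{il}}{4p}\Big[U^{(\mu)}_{(l)m}x^m_\mu+\frac{\partial U^{(\mu)}_{(l)}}{\partial t^\mu}+U^{(\mu)}_{(l)}H^\gamma_{\mu\gamma}-\frac{\partial\Phi}{\partial x^l}\Big],$$ $M^{(i)}_{(\alpha)\beta}=2H^{(i)}_{(\alpha)\beta}$, $N^{(i)}_{(\alpha)j}=h_{\alpha\gamma}\,\partial(h^{\mu\nu}G^{(i)}_{(\mu)\nu})/\partial x^j_\gamma$. Let $(X_A)=(\delta/\delta t^\alpha,\delta/\delta x^i,\partial/\partial x^i_\alpha)$ and $(dt^\alpha,dx^i,\delta x^i_\alpha)$ be the adapted bases, where $\delta/\delta t^\alpha=\partial/\partial t^\alpha-M^{(j)}_{(\beta)\alpha}\partial/\partial x^j_\beta$, $\delta/\delta x^i=\partial/\partial x^i-N^{(j)}_{(\beta)i}\partial/\partial x^j_\beta$, $\delta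 x^i_\alpha=dx^i_\alpha+M^{(i)}_{(\alpha)\beta}dt^\beta+N^{(i)}_{(\alpha)j}dx^j$. *Gravitational $h$-potential and Cartan connection.* Let $g_{ij}=\frac1p h_{\alpha\beta}\cdot\frac12\frac{\partial^2L}{\partial x^i_\alpha\partial x^j_\beta}$. The gravitational $h$-potential induced by $L$ is $G=h_{\alpha\beta}dt^\alpha\otimes dt^\beta+g_{ij}dx^i\otimes dx^j+h^{\alpha\beta}g_{ij}\,\delta x^i_\alpha\otimes\delta x^j_\beta$. The generalized Cartan canonical connection $D$ preserves the three adapted distributions and has the adapted components $H^\gamma_{\alpha\beta}$, $G^k_{j\gamma}=\frac12g^{km}\frac{\delta g_{mj}}{\delta t^\gamma}$, $L^k_{ij}=\frac12g^{km}\big(\frac{\delta g_{jm}}{\delta x^i}+\frac{\delta g_{im}}{\delta x^j}-\frac{\delta g_{ij}}{\delta x^m}\big)$, $C^{k(\gamma)}_{i(j)}=\frac12g^{km}\big(\frac{\partial g_{jm}}{\partial x^i_\gamma}+\frac{\partial g_{im}}{\partial x^j_\gamma}-\frac{\partial g_{ij}}{\partial x^m_\gamma}\big)$: for $X_B=\delta/\delta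 t^\gamma,\ \delta/\delta x^j,\ \partial/\partial x^j_\gamma$ respectively, $D_{X_B}\frac{\delta}{\delta t^\beta}=H^\alpha_{\beta\gamma}\frac{\delta}{\delta t^\alpha},\,0,\,0$; $D_{X_B}\frac{\delta}{\delta x^i}=G^k_{i\gamma}\frac{\delta}{\delta x^k},\ L^k_{ij}\frac{\delta}{\delta x^k},\ C^{k(\gamma)}_{i(j)}\frac{\delta}{\delta x^k}$; and $D_{X_B}\frac{\partial}{\partial x^i_\alpha}$ has $\frac{\partial}{\partial x^k_\beta}$-component $\delta^\alpha_\beta G^k_{i\gamma}-\delta^k_iH^\alpha_{\beta\gamma},\ \delta^\alpha_\beta L^k_{ij},\ \delta^\alpha_\beta C^{k(\gamma)}_{i(j)}$. Its curvature is $R(X_C,X_B)X_A=R^D_{ABC}X_D$, its Ricci tensor $R_{AB}=R^D_{ABD}$ and its scalar curvature $\mathrm{Sc}=G^{AB}R_{AB}$. Given a constant $\mathcal K\neq0$, the generalized Einstein equations for a stress-energy d-tensor $\mathcal T$ (a $(0,2)$-tensor field with adapted components $\mathcal T_{AB}=\mathcal T(X_A,X_B)$) are $$R_{AB}-\tfrac12\mathrm{Sc}\,G_{AB}=\mathcal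 K\,\mathcal T_{AB}\quad\text{for all }A,B.$$ Then, in the jet coordinates induced by any charts of $T$ and $M$: (i) $\frac12\frac{\partial^2L}{\partial x^i_\alpha\partial x^j_\beta}=h^{\alpha\beta}\varphi_{ij}$, and the gravitational $h$-potential is the (symmetric, positive definite) Sasakian-like metric $$G=h_{\alpha\beta}dt^\alpha\otimes dt^\beta+\varphi_{ij}dx^i\otimes dx^j+h^{\alpha\beta}\varphi_{ij}\,\delta x^i_\alpha\otimes\delta x^j_\beta.$$ (ii) The generalized Einstein equations hold at a point if and only if $(E_1)$ and $(E_2)$ hold there: $$(E_1)\quad H_{\alpha\beta}-\tfrac{H+r}2h_{\alpha\beta}=\mathcal K\mathcal T_{\alpha\beta},\quad r_{ij}-\tfrac{H+r}2\varphi_{ij}=\mathcal K\mathcal T_{ij},\quad-\tfrac{H+r}2h^{\alpha\beta}\varphi_{ij}=\mathcal K\mathcal T^{(\alpha)(\beta)}_{(i)(j)},$$ $$(E_2)\quad 0=\mathcal T_{\alpha i}=\mathcal T_{i\alpha}=\mathcal T^{(\alpha)}_{(i)\beta}=\mathcal T^{\ (\beta)}_{\alpha(i)}=\mathcal T^{\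 (\alpha)}_{i(j)}=\mathcal T^{(\alpha)}_{(i)j}.$$ (iii) If $\mathcal T$ satisfies the generalized Einstein equations on the domain of the jet coordinates, then $\mathcal T^\mu_\beta=h^{\mu\alpha}\mathcal T_{\alpha\beta}$ and $\mathcal T^m_j=\varphi^{mi}\mathcal T_{ij}$ satisfy the conservation laws $$\mathcal T^\mu_{\beta//\mu}=0,\qquad\mathcal T^m_{j\Vert m}=0,$$ where, with $\frac{\delta_0}{\delta t^\gamma}=\frac{\partial}{\partial t^\gamma}+H^\mu_{\beta\gamma}x^j_\mu\frac{\partial}{\partial x^j_\beta}$ and $\frac{\delta_0}{\delta x^k}=\frac{\partial}{\partial x^k}-\gamma^j_{km}x^m_\beta\frac{\partial}{\partial x^j_\beta}$, the Berwald covariant derivatives are $\mathcal T^\mu_{\beta//\gamma}=\frac{\delta_0\mathcal T^\mu_\beta}{\delta t^\gamma}+H^\mu_{\nu\gamma}\mathcal T^\nu_\beta-H^\nu_{\beta\gamma}\mathcal T^\mu_\nu$ and $\mathcal T^m_{j\Vert k}=\frac{\delta_0\mathcal T^m_j}{\delta x^k}+\gamma^m_{sk}\mathcal T^s_j-\gamma^s_{jk}\mathcal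 T^m_s$. -/

import Mathlib

open scoped Manifold ContDiff

namespace JetGravity

noncomputable section

/-! ### Local Riemannian geometry in coordinates -/

/-- `∂F/∂u^a` on `ℝ^m`. -/
def pd {m : ℕ} (a : Fin m) (F : EuclideanSpace ℝ (Fin m) → ℝ) (u : EuclideanSpace ℝ (Fin m)) : ℝ :=
  fderiv ℝ F u (EuclideanSpace.single a 1)

/-- A field of `m × m` matrices on `ℝ^m` (components of a metric in a chart). -/
abbrev MatField (m : ℕ) := EuclideanSpace ℝ (Fin m) → Matrix (Fin m) (Fin m) ℝ

/-- Christoffel symbols `Γ^k_{ij}`. -/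
def christoffel {m : ℕ} (g : MatField m) (k i j : Fin m) (u : EuclideanSpace ℝ (Fin m)) : ℝ :=
  (1 / 2) * ∑ l, (g u)⁻¹ k l *
    (pd i (fun w => g w j l) u + pd j (fun w => g w i l) u - pd l (fun w => g w i j) u)

/-- Curvature components `r^l_{ijk}`, normalised by `R(∂_k, ∂_j) ∂_i = r^l_{ijk} ∂_l`. -/
def riemann {m : ℕ} (g : MatField m) (l i j k : Fin m) (u : EuclideanSpace ℝ (Fin m)) : ℝ :=
  pd k (christoffel g l i j) u - pd j (christoffel g l i k) u
    + ∑ s, (christoffel g s i j u * christoffel g l s k u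
      - christoffel g s i k u * christoffel g l s j u)

/-- Ricci tensor `r_{ij} = r^s_{ijs}`. -/
def ricci {m : ℕ} (g : MatField m) (i j : Fin m) (u : EuclideanSpace ℝ (Fin m)) : ℝ :=
  ∑ s, riemann g s i j s u

/-- Scalar curvature `g^{ij} r_{ij}`. -/
def scalarCurv {m : ℕ} (g : MatField m) (u : EuclideanSpace ℝ (Fin m)) : ℝ :=
  ∑ i, ∑ j, (g u)⁻¹ i j * ricci g i j u

/-! ### Jet coordinates, nonlinear connections, adapted frames -/

/-- Local coordinates `(t^α, x^i, x^i_α)` on `J¹(T, M)`; the last entry is `z.2.2 i α`.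
The same space contains the components of tangent vectors of `J¹(T, M)`. -/
abbrev JetCoord (p n : ℕ) :=
  EuclideanSpace ℝ (Fin p) × EuclideanSpace ℝ (Fin n) × (Fin n → Fin p → ℝ)

/-- Indices of an adapted frame: `α`, `i`, or the pair `(i, α)` for `∂/∂x^i_α`. -/
abbrev AIdx (p n : ℕ) := Fin p ⊕ Fin n ⊕ (Fin n × Fin p)

/-- The vertical coordinate vector `∂/∂x^i_α`. -/
def vert {p n : ℕ} (i : Fin n) (α : Fin p) : JetCoord p n :=
  (0, 0, fun j β => if j = i ∧ β = α then 1 else 0)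

/-- `M i α β = M^{(i)}_{(α)β}`, `N i α j = N^{(i)}_{(α)j}`. -/
structure NonlinearConnection (p n : ℕ) where
  M : Fin n → Fin p → Fin p → JetCoord p n → ℝ
  N : Fin n → Fin p → Fin n → JetCoord p n → ℝ

variable {p n : ℕ}

/-- The adapted frame `δ/δt^α`, `δ/δx^i`, `∂/∂x^i_α`. -/
def frame (Γ : NonlinearConnection p n) : AIdx p n → JetCoord p n → JetCoord p n
  | .inl α, z => (EuclideanSpace.single α 1, 0, fun j β => -Γ.M j β α z)
  | .inr (.inl i), z => (0, EuclideanSpace.single i 1, fun j β => -Γ.N j β i z)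
  | .inr (.inr (i, α)), _ => vert i α

/-- The form `δx^i_α = dx^i_α + M^{(i)}_{(α)β} dt^β + N^{(i)}_{(α)j} dx^j`, evaluated at `v`. -/
def deltaX (Γ : NonlinearConnection p n) (i : Fin n) (α : Fin p) (z v : JetCoord p n) : ℝ :=
  v.2.2 i α + ∑ β, Γ.M i α β z * v.1 β + ∑ j, Γ.N i α j z * v.2.1 j

/-- The adapted coframe `dt^α`, `dx^i`, `δx^i_α`. -/
def coframe (Γ : NonlinearConnection p n) : AIdx p n → JetCoord p n → JetCoord p n → ℝ
  | .inl α, _, v => v.1 α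
  | .inr (.inl i), _, v => v.2.1 i
  | .inr (.inr (i, α)), z, v => deltaX Γ i α z v

/-- The derivative `X_A(F)` along the adapted frame. -/
def frameDeriv (Γ : NonlinearConnection p n) (A : AIdx p n) (F : JetCoord p n → ℝ)
    (z : JetCoord p n) : ℝ :=
  fderiv ℝ F z (frame Γ A z)

/-! ### Linear connections given by coefficients in an adapted frame -/

/-- `conn C A B` is the coefficient in `D_{X_B} X_A = ∑_C (conn C A B) X_C`. -/
abbrev ConnCoeff (p n : ℕ) := AIdx p n → AIdx p n → AIdx p n → JetCoord p n → ℝ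

/-- `D_V Y`. -/
def covDeriv (Γ : NonlinearConnection p n) (conn : ConnCoeff p n)
    (V Y : JetCoord p n → JetCoord p n) (z : JetCoord p n) : JetCoord p n :=
  ∑ C, (fderiv ℝ (fun w => coframe Γ C w (Y w)) z (V z)
    + ∑ A, ∑ B, conn C A B z * coframe Γ A z (Y z) * coframe Γ B z (V z)) • frame Γ C z

/-- `R(U,V)W = D_U D_V W - D_V D_U W - D_{[U,V]} W`. -/
def curvature (Γ : NonlinearConnection p n) (conn : ConnCoeff p n)
    (U V W : JetCoord p n → JetCoord p n) (z : JetCoord p n) : JetCoord p n :=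
  covDeriv Γ conn U (covDeriv Γ conn V W) z - covDeriv Γ conn V (covDeriv Γ conn U W) z
    - covDeriv Γ conn (VectorField.lieBracket ℝ U V) W z

/-- `R_{AB} = R^D_{ABD}`, where `R(X_C, X_B) X_A = R^D_{ABC} X_D`. -/
def ricciD (Γ : NonlinearConnection p n) (conn : ConnCoeff p n) (A B : AIdx p n)
    (z : JetCoord p n) : ℝ :=
  ∑ D, coframe Γ D z (curvature Γ conn (frame Γ D) (frame Γ B) (frame Γ A) z)

/-- Adapted components `G(X_A, X_B)` of a bilinear form field `G`. -/
def adaptedComp (Γ : NonlinearConnection p n)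
    (G : JetCoord p n → JetCoord p n → JetCoord p n → ℝ) (z : JetCoord p n) :
    Matrix (AIdx p n) (AIdx p n) ℝ :=
  Matrix.of fun A B => G z (frame Γ A z) (frame Γ B z)

/-- `Sc = G^{AB} R_{AB}`. -/
def scalarD (Γ : NonlinearConnection p n) (conn : ConnCoeff p n)
    (G : JetCoord p n → JetCoord p n → JetCoord p n → ℝ) (z : JetCoord p n) : ℝ :=
  ∑ A, ∑ B, (adaptedComp Γ G z)⁻¹ A B * ricciD Γ conn A B z

/-! ### Objects attached to a multi-time Lagrangian -/

/-- Fundamental vertical metrical d-tensor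
`G^{(α)(β)}_{(i)(j)} = (1/2) ∂²L / ∂x^i_α ∂x^j_β`. -/
def verticalMetric (L : JetCoord p n → ℝ) (i : Fin n) (α : Fin p) (j : Fin n) (β : Fin p)
    (z : JetCoord p n) : ℝ :=
  (1 / 2) * fderiv ℝ (fun w => fderiv ℝ L w (vert j β)) z (vert i α)

/-- The spatial metric `g_{ij}` with `G^{(α)(β)}_{(i)(j)} = h^{αβ} g_{ij}`, recovered from the
vertical metrical d-tensor by contraction with `h_{αβ}`. -/
def spatialMetric (h : MatField p) (L : JetCoord p n → ℝ) (z : JetCoord p n) :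
    Matrix (Fin n) (Fin n) ℝ :=
  Matrix.of fun i j => (1 / (p : ℝ)) * ∑ α, ∑ β, h z.1 α β * verticalMetric L i α j β z

/-- The gravitational `h`-potential
`h_{αβ} dt^α⊗dt^β + g_{ij} dx^i⊗dx^j + h^{αβ} g_{ij} δx^i_α⊗δx^j_β` induced by `L`. -/
def hPotential (h : MatField p) (L : JetCoord p n → ℝ) (Γ : NonlinearConnection p n)
    (z v w : JetCoord p n) : ℝ :=
  (∑ α, ∑ β, h z.1 α β * v.1 α * w.1 β)
    + (∑ i, ∑ j, spatialMetric h L z i j * v.2.1 i * w.2.1 j)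
    + ∑ i, ∑ j, ∑ α, ∑ β, (h z.1)⁻¹ α β * spatialMetric h L z i j
        * deltaX Γ i α z v * deltaX Γ j β z w

/-- `G^k_{jγ} = (1/2) g^{km} δg_{mj}/δt^γ`. -/
def cartanG (h : MatField p) (L : JetCoord p n → ℝ) (Γ : NonlinearConnection p n)
    (k j : Fin n) (γ : Fin p) (z : JetCoord p n) : ℝ :=
  (1 / 2) * ∑ m, (spatialMetric h L z)⁻¹ k m *
    frameDeriv Γ (.inl γ) (fun w => spatialMetric h L w m j) z

/-- `L^k_{ij} = (1/2) g^{km} (δg_{jm}/δx^i + δg_{im}/δx^j - δg_{ij}/δx^m)`. -/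
def cartanL (h : MatField p) (L : JetCoord p n → ℝ) (Γ : NonlinearConnection p n)
    (k i j : Fin n) (z : JetCoord p n) : ℝ :=
  (1 / 2) * ∑ m, (spatialMetric h L z)⁻¹ k m *
    (frameDeriv Γ (.inr (.inl i)) (fun w => spatialMetric h L w j m) z
      + frameDeriv Γ (.inr (.inl j)) (fun w => spatialMetric h L w i m) z
      - frameDeriv Γ (.inr (.inl m)) (fun w => spatialMetric h L w i j) z)

/-- `C^{k(γ)}_{i(j)} = (1/2) g^{km} (∂g_{jm}/∂x^i_γ + ∂g_{im}/∂x^j_γ - ∂g_{ij}/∂x^m_γ)`. -/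
def cartanC (h : MatField p) (L : JetCoord p n → ℝ) (Γ : NonlinearConnection p n)
    (k i j : Fin n) (γ : Fin p) (z : JetCoord p n) : ℝ :=
  (1 / 2) * ∑ m, (spatialMetric h L z)⁻¹ k m *
    (frameDeriv Γ (.inr (.inr (i, γ))) (fun w => spatialMetric h L w j m) z
      + frameDeriv Γ (.inr (.inr (j, γ))) (fun w => spatialMetric h L w i m) z
      - frameDeriv Γ (.inr (.inr (m, γ))) (fun w => spatialMetric h L w i j) z)

/-- The generalized Cartan canonical connection: the `h`-normal `Γ`-linear connection with adapted
components `(H^γ_{αβ}, G^k_{jγ}, L^k_{ij}, C^{k(γ)}_{i(j)})`. It preserves the three distributions;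
on the vertical one `D_{X_B} ∂/∂x^i_α` has `∂/∂x^k_β`-component
`δ^α_β G^k_{iγ} - δ^k_i H^α_{βγ}`, `δ^α_β L^k_{ij}`, `δ^α_β C^{k(γ)}_{i(j)}` for
`X_B = δ/δt^γ`, `δ/δx^j`, `∂/∂x^j_γ`. -/
def cartan (h : MatField p) (L : JetCoord p n → ℝ) (Γ : NonlinearConnection p n) : ConnCoeff p n
  | .inl α, .inl β, .inl γ, z => christoffel h α β γ z.1
  | .inr (.inl k), .inr (.inl i), .inl γ, z => cartanG h L Γ k i γ z
  | .inr (.inl k), .inr (.inl i), .inr (.inl j), z => cartanL h L Γ k i j z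
  | .inr (.inl k), .inr (.inl i), .inr (.inr (j, γ)), z => cartanC h L Γ k i j γ z
  | .inr (.inr (k, β)), .inr (.inr (i, α)), .inl γ, z =>
      (if α = β then cartanG h L Γ k i γ z else 0)
        - (if k = i then christoffel h α β γ z.1 else 0)
  | .inr (.inr (k, β)), .inr (.inr (i, α)), .inr (.inl j), z =>
      if α = β then cartanL h L Γ k i j z else 0
  | .inr (.inr (k, β)), .inr (.inr (i, α)), .inr (.inr (j, γ)), z =>
      if α = β then cartanC h L Γ k i j γ z else 0
  | _, _, _, _ => 0

/-! ### The canonical spray and nonlinear connection of the electrodynamics Lagrangian -/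

/-- Local components `X^{(i)}_{(α)}(t, x)`. -/
abbrev FieldComp (p n : ℕ) :=
  EuclideanSpace ℝ (Fin p) → EuclideanSpace ℝ (Fin n) → Fin n → Fin p → ℝ

/-- `U^{(α)}_{(i)} = -2 h^{αμ} φ_{im} X^{(m)}_{(μ)}`. -/
def potU (h : MatField p) (φ : MatField n) (X : FieldComp p n) (i : Fin n) (α : Fin p)
    (u : EuclideanSpace ℝ (Fin p)) (y : EuclideanSpace ℝ (Fin n)) : ℝ :=
  -2 * ∑ μ, ∑ m, (h u)⁻¹ α μ * φ y i m * X u y m μ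

/-- `Φ = h^{μν} φ_{rs} X^{(r)}_{(μ)} X^{(s)}_{(ν)}`. -/
def potPhi (h : MatField p) (φ : MatField n) (X : FieldComp p n)
    (u : EuclideanSpace ℝ (Fin p)) (y : EuclideanSpace ℝ (Fin n)) : ℝ :=
  ∑ μ, ∑ ν, ∑ r, ∑ s, (h u)⁻¹ μ ν * φ y r s * X u y r μ * X u y s ν

/-- Temporal spray components `H^{(i)}_{(α)β} = -(1/2) H^γ_{αβ} x^i_γ`. -/
def temporalSpray (h : MatField p) (i : Fin n) (α β : Fin p) (z : JetCoord p n) : ℝ :=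
  -(1 / 2) * ∑ γ, christoffel h γ α β z.1 * z.2.2 i γ

/-- Spatial spray components
`G^{(i)}_{(α)β} = (1/2) γ^i_{jk} x^j_α x^k_β + (h_{αβ} φ^{il} / 4p)
  [U^{(μ)}_{(l)m} x^m_μ + ∂U^{(μ)}_{(l)}/∂t^μ + U^{(μ)}_{(l)} H^γ_{μγ} - ∂Φ/∂x^l]`,
`U^{(μ)}_{(l)m} = ∂U^{(μ)}_{(l)}/∂x^m - ∂U^{(μ)}_{(m)}/∂x^l`. -/
def spatialSpray (h : MatField p) (φ : MatField n) (X : FieldComp p n)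
    (i : Fin n) (α β : Fin p) (z : JetCoord p n) : ℝ :=
  (1 / 2) * (∑ j, ∑ k, christoffel φ i j k z.2.1 * z.2.2 j α * z.2.2 k β)
    + h z.1 α β / (4 * p) * ∑ l, (φ z.2.1)⁻¹ i l *
      ((∑ μ, ∑ m, (pd m (fun y => potU h φ X l μ z.1 y) z.2.1
            - pd l (fun y => potU h φ X m μ z.1 y) z.2.1) * z.2.2 m μ)
        + (∑ μ, pd μ (fun u => potU h φ X l μ u z.2.1) z.1)
        + (∑ μ, ∑ γ, potU h φ X l μ z.1 z.2.1 * christoffel h γ μ γ z.1)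
        - pd l (fun y => potPhi h φ X z.1 y) z.2.1)

/-- The canonical nonlinear connection: `M^{(i)}_{(α)β} = 2 H^{(i)}_{(α)β}` and
`N^{(i)}_{(α)j} = (∂𝒢^i/∂x^j_γ) h_{αγ}` with `𝒢^i = h^{αβ} G^{(i)}_{(α)β}`. -/
def canonicalConnection (h : MatField p) (φ : MatField n) (X : FieldComp p n) :
    NonlinearConnection p n where
  M i α β z := 2 * temporalSpray h i α β z
  N i α j z := ∑ γ, fderiv ℝ
    (fun w : JetCoord p n => ∑ μ, ∑ ν, (h w.1)⁻¹ μ ν * spatialSpray h φ X i μ ν w) z (vert j γ)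
      * h z.1 α γ

/-- The nonlinear connection associated to the pair of metrics:
`M^{(i)}_{(α)β} = -H^μ_{αβ} x^i_μ`, `N^{(i)}_{(α)j} = γ^i_{jm} x^m_α`. -/
def metricConnection (h : MatField p) (φ : MatField n) : NonlinearConnection p n where
  M i α β z := -∑ μ, christoffel h μ α β z.1 * z.2.2 i μ
  N i α j z := ∑ m, christoffel φ i j m z.2.1 * z.2.2 m α

/-- Berwald covariant derivative `S^μ_{β//γ}` of a d-tensor field `S^μ_β`. -/
def berwaldT (h : MatField p) (φ : MatField n) (S : Fin p → Fin p → JetCoord p n → ℝ)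
    (μ β γ : Fin p) (z : JetCoord p n) : ℝ :=
  frameDeriv (metricConnection h φ) (.inl γ) (S μ β) z
    + ∑ ν, (christoffel h μ ν γ z.1 * S ν β z - christoffel h ν β γ z.1 * S μ ν z)

/-- Berwald covariant derivative `S^m_{j‖k}` of a d-tensor field `S^m_j`. -/
def berwaldM (h : MatField p) (φ : MatField n) (S : Fin n → Fin n → JetCoord p n → ℝ)
    (m j k : Fin n) (z : JetCoord p n) : ℝ :=
  frameDeriv (metricConnection h φ) (.inr (.inl k)) (S m j) z
    + ∑ s, (christoffel φ m s k z.2.1 * S s j z - christoffel φ s j k z.2.1 * S m s z)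

/-! ### The jet bundle, the least squares Lagrangian and local components -/

/-- A smooth Riemannian metric on an `m`-dimensional manifold. -/
abbrev RiemMetric (m : ℕ) (B : Type*) [TopologicalSpace B]
    [ChartedSpace (EuclideanSpace ℝ (Fin m)) B] [IsManifold (𝓡 m) ∞ B] :=
  Bundle.ContMDiffRiemannianMetric (𝓡 m) ∞ (EuclideanSpace ℝ (Fin m))
    (fun b : B => TangentSpace (𝓡 m) b)

section Manifolds

variable {T M : Type*} [TopologicalSpace T] [ChartedSpace (EuclideanSpace ℝ (Fin p)) T]
  [TopologicalSpace M] [ChartedSpace (EuclideanSpace ℝ (Fin n)) M]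

variable (p n T M) in
/-- The first order jet space `J¹(T, M)`: triples `(t, x, A)` with `A : T_t T → T_x M` linear. -/
structure Jet1 where
  time : T
  point : M
  lin : TangentSpace (𝓡 p) time →L[ℝ] TangentSpace (𝓡 n) point

variable (p n T M) in
/-- A family of linear maps `X(t, x) : T_t T → T_x M`. -/
abbrev JetField := ∀ (t : T) (x : M), TangentSpace (𝓡 p) t →L[ℝ] TangentSpace (𝓡 n) x

/-- Smoothness of `X`: the map `(v, x) ↦ X(t, x) v`, `v ∈ T_t T`, from `TT × M` to `TM`
is smooth. -/
def JetField.IsSmooth [IsManifold (𝓡 p) ∞ T] [IsManifold (𝓡 n) ∞ M] (X : JetField p n T M) :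
    Prop :=
  ContMDiff ((𝓡 p).tangent.prod (𝓡 n)) (𝓡 n).tangent ∞
    (fun q : TangentBundle (𝓡 p) T × M =>
      (⟨q.2, X q.1.proj q.2 q.1.snd⟩ : TangentBundle (𝓡 n) M))

/-- The least squares Lagrangian `L(t, x, A) = ‖A - X(t, x)‖²`, i.e.
`h^{αβ} φ((A - X) b_α, (A - X) b_β)` for a basis `b` of `T_t T` and the inverse `h^{αβ}` of the
matrix `h(b_α, b_β)` (the value does not depend on `b`; the standard basis of the model space, which
is the coordinate basis of the preferred chart at `t`, is used). -/
def leastSquares [IsManifold (𝓡 p) ∞ T] [IsManifold (𝓡 n) ∞ M]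
    (h : RiemMetric p T) (φ : RiemMetric n M) (X : JetField p n T M) (j : Jet1 p n T M) : ℝ :=
  let b : Fin p → TangentSpace (𝓡 p) j.time :=
    fun α => (EuclideanSpace.single α (1 : ℝ) : EuclideanSpace ℝ (Fin p))
  let D := j.lin - X j.time j.point
  ∑ α, ∑ β, (Matrix.of fun α β => h.inner j.time (b α) (b β))⁻¹ α β
    * φ.inner j.point (D (b α)) (D (b β))

/-- The coordinate vector `∂_a` of the chart `e`, at the point with coordinates `u`. -/
def coordVec {m : ℕ} {B : Type*} [TopologicalSpace B] [ChartedSpace (EuclideanSpace ℝ (Fin m)) B]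
    (e : OpenPartialHomeomorph B (EuclideanSpace ℝ (Fin m))) (a : Fin m)
    (u : EuclideanSpace ℝ (Fin m)) : TangentSpace (𝓡 m) (e.symm u) :=
  mfderiv (𝓡 m) (𝓡 m) e.symm u (EuclideanSpace.single a (1 : ℝ) : EuclideanSpace ℝ (Fin m))

/-- The coordinate form `du^a` of the chart `e`, at the point `q`. -/
def coordForm {m : ℕ} {B : Type*} [TopologicalSpace B] [ChartedSpace (EuclideanSpace ℝ (Fin m)) B]
    (e : OpenPartialHomeomorph B (EuclideanSpace ℝ (Fin m))) (a : Fin m) (q : B) :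
    TangentSpace (𝓡 m) q →L[ℝ] ℝ :=
  (EuclideanSpace.proj a : EuclideanSpace ℝ (Fin m) →L[ℝ] ℝ).comp (mfderiv (𝓡 m) (𝓡 m) e q)

/-- Components of a Riemannian metric in the chart `e`. -/
def metricComp {m : ℕ} {B : Type*} [TopologicalSpace B]
    [ChartedSpace (EuclideanSpace ℝ (Fin m)) B] [IsManifold (𝓡 m) ∞ B] (g : RiemMetric m B)
    (e : OpenPartialHomeomorph B (EuclideanSpace ℝ (Fin m))) : MatField m :=
  fun u => Matrix.of fun a b => g.inner (e.symm u) (coordVec e a u) (coordVec e b u)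

/-- Components `X^{(i)}_{(α)} = dx^i (X(∂/∂t^α))`. -/
def fieldComp (X : JetField p n T M) (e : OpenPartialHomeomorph T (EuclideanSpace ℝ (Fin p)))
    (f : OpenPartialHomeomorph M (EuclideanSpace ℝ (Fin n))) : FieldComp p n :=
  fun u y i α => coordForm f i (f.symm y) (X (e.symm u) (f.symm y) (coordVec e α u))

/-- The jet with coordinates `(t^α, x^i, x^i_α)`: its linear part is `x^i_α dt^α ⊗ ∂/∂x^i`. -/
def jetPoint (e : OpenPartialHomeomorph T (EuclideanSpace ℝ (Fin p)))
    (f : OpenPartialHomeomorph M (EuclideanSpace ℝ (Fin n))) (z : JetCoord p n) : Jet1 p n T M where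
  time := e.symm z.1
  point := f.symm z.2.1
  lin := ∑ i, ∑ α, z.2.2 i α • (coordForm e α (e.symm z.1)).smulRight (coordVec f i z.2.1)

/-- The range of the jet coordinates induced by the charts `e` and `f`. -/
def jetDomain (e : OpenPartialHomeomorph T (EuclideanSpace ℝ (Fin p)))
    (f : OpenPartialHomeomorph M (EuclideanSpace ℝ (Fin n))) : Set (JetCoord p n) :=
  {z | z.1 ∈ e.target ∧ z.2.1 ∈ f.target}

end Manifolds

end

end JetGravity

/-! The least squares Lagrangian is quadratic in the jet variables and its vertical Hessian is
`h^{αβ} φ_{ij}`. Contracting with `h_{αβ}` and dividing by `p` gives `g_{ij} = φ_{ij}(x)`, a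
function of `x` alone. This forces everything else. An adapted frame vector differs from the
coordinate vector only by vertical terms, which annihilate functions of `(t, x)`. Hence `G^k_{jγ}`
and `C^{k(γ)}_{i(j)}` vanish, `L^k_{ij} = γ^k_{ij}`, and the Cartan connection has the Levi-Civita
coefficients of `h` and `φ`, for any nonlinear connection (`cartan_eq_baseConn`).

The `dt` and `dx` components of the adapted frame are constant, so brackets of frame fields are
vertical. The connection is trivial in vertical directions, so the bracket term of the curvature
drops out (`coframe_curvature`). The contraction leaves the Ricci tensor block diagonal with blocks
`H_{αβ}`, `r_{ij}` and `0` (`ricciD_eq_baseRicci`). As the potential is block diagonal too, `Sc = H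
+ r`, and the Einstein equations split into blocks (`einstein_iff`).

For the conservation laws, the equations identify `𝒯^μ_β` with `K⁻¹ (H^μ_β - (H + r)/2 δ^μ_β)`. The
temporal Berwald derivative does not see `r(x)`, so the divergence vanishes by the contracted
Bianchi identity for `h`; the spatial law is the same with the roles exchanged. That identity
(`contracted_bianchi`) comes from matrix calculus: the second Bianchi identity for the curvature
matrices `R_{jk}`, multiplied by the parallel matrix `g⁻¹`, is traced twice. The manifolds enter
only through smooth, positive definite chart components and the coordinate formula for `L`
(`leastSquares_jetPoint`). -/

namespace JetGravity

/-! ### Partial derivatives of functions and of matrix fields. -/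

section Partials

variable {m : ℕ} {U : Set (EuclideanSpace ℝ (Fin m))} {F G : EuclideanSpace ℝ (Fin m) → ℝ}
  {u : EuclideanSpace ℝ (Fin m)}

theorem pd_congr (hU : IsOpen U) (h : Set.EqOn F G U) (hu : u ∈ U) (a : Fin m) :
    pd a F u = pd a G u := by
  unfold pd
  rw [Filter.EventuallyEq.fderiv_eq (Filter.eventually_of_mem (hU.mem_nhds hu) h)]

theorem pd_add (hF : DifferentiableAt ℝ F u) (hG : DifferentiableAt ℝ G u) (a : Fin m) :
    pd a (fun w => F w + G w) u = pd a F u + pd a G u := by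
  simp [pd, fderiv_fun_add hF hG]

theorem pd_sub (hF : DifferentiableAt ℝ F u) (hG : DifferentiableAt ℝ G u) (a : Fin m) :
    pd a (fun w => F w - G w) u = pd a F u - pd a G u := by
  simp [pd, fderiv_fun_sub hF hG]

theorem pd_neg (a : Fin m) : pd a (fun w => -F w) u = -pd a F u := by
  simp [pd, fderiv_fun_neg]

theorem pd_mul (hF : DifferentiableAt ℝ F u) (hG : DifferentiableAt ℝ G u) (a : Fin m) :
    pd a (fun w => F w * G w) u = pd a F u * G u + F u * pd a G u := by
  simp [pd, fderiv_fun_mul hF hG]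
  ring

theorem pd_sum {ι : Type*} {s : Finset ι} {F : ι → EuclideanSpace ℝ (Fin m) → ℝ}
    (hF : ∀ i ∈ s, DifferentiableAt ℝ (F i) u) (a : Fin m) :
    pd a (fun w => ∑ i ∈ s, F i w) u = ∑ i ∈ s, pd a (F i) u := by
  simp [pd, fderiv_fun_sum hF]

theorem contDiffOn_pd (hU : IsOpen U) (hF : ContDiffOn ℝ ∞ F U) (a : Fin m) :
    ContDiffOn ℝ ∞ (pd a F) U :=
  (hF.fderiv_of_isOpen hU (m := ∞) (by simp)).clm_apply contDiffOn_const

theorem differentiableAt_of_contDiffOn (hU : IsOpen U) (hF : ContDiffOn ℝ ∞ F U) (hu : u ∈ U) :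
    DifferentiableAt ℝ F u :=
  (hF.differentiableOn (by simp)).differentiableAt (hU.mem_nhds hu)

theorem pd_comm (hU : IsOpen U) (hF : ContDiffOn ℝ ∞ F U) (hu : u ∈ U) (a b : Fin m) :
    pd a (pd b F) u = pd b (pd a F) u := by
  have h1 : DifferentiableAt ℝ (fderiv ℝ F) u :=
    ((hF.fderiv_of_isOpen hU (m := ∞) (by simp)).differentiableOn (by simp)).differentiableAt
      (hU.mem_nhds hu)
  have h2 : IsSymmSndFDerivAt ℝ F u :=
    (hF.contDiffAt (hU.mem_nhds hu)).isSymmSndFDerivAt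
      (by simp only [minSmoothness_of_isRCLikeNormedField]; exact ENat.LEInfty.out)
  have h3 (c d : Fin m) : pd c (pd d F) u
      = fderiv ℝ (fderiv ℝ F) u (EuclideanSpace.single c 1) (EuclideanSpace.single d 1) := by
    unfold pd
    rw [fderiv_clm_apply h1 (differentiableAt_const _)]
    simp
  rw [h3, h3, h2]

end Partials

section MatrixPartials

variable {m : ℕ} {U : Set (EuclideanSpace ℝ (Fin m))} {F G : MatField m}
  {u : EuclideanSpace ℝ (Fin m)}

/-- Entrywise partial derivative of a matrix field. -/
noncomputable def pdMat (k : Fin m) (F : MatField m) : MatField m :=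
  fun u => Matrix.of fun a b => pd k (fun w => F w a b) u

/-- Entrywise smoothness of a matrix field. -/
def SmoothMatOn (F : MatField m) (U : Set (EuclideanSpace ℝ (Fin m))) : Prop :=
  ∀ a b, ContDiffOn ℝ ∞ (fun u => F u a b) U

theorem SmoothMatOn.differentiableAt (hU : IsOpen U) (hF : SmoothMatOn F U) (hu : u ∈ U)
    (a b : Fin m) : DifferentiableAt ℝ (fun w => F w a b) u :=
  differentiableAt_of_contDiffOn hU (hF a b) hu

theorem SmoothMatOn.add (hF : SmoothMatOn F U) (hG : SmoothMatOn G U) :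
    SmoothMatOn (fun u => F u + G u) U :=
  fun a b => (hF a b).add (hG a b)

theorem SmoothMatOn.sub (hF : SmoothMatOn F U) (hG : SmoothMatOn G U) :
    SmoothMatOn (fun u => F u - G u) U :=
  fun a b => (hF a b).sub (hG a b)

theorem SmoothMatOn.transpose (hF : SmoothMatOn F U) :
    SmoothMatOn (fun u => (F u).transpose) U :=
  fun a b => hF b a

theorem SmoothMatOn.mul (hF : SmoothMatOn F U) (hG : SmoothMatOn G U) :
    SmoothMatOn (fun u => F u * G u) U := by
  intro a b
  simp only [Matrix.mul_apply]
  exact ContDiffOn.sum fun i _ => (hF a i).mul (hG i b)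

theorem SmoothMatOn.pdMat (hU : IsOpen U) (hF : SmoothMatOn F U) (k : Fin m) :
    SmoothMatOn (pdMat k F) U :=
  fun a b => contDiffOn_pd hU (hF a b) k

theorem SmoothMatOn.det (hF : SmoothMatOn F U) : ContDiffOn ℝ ∞ (fun u => (F u).det) U := by
  simp only [Matrix.det_apply]
  exact ContDiffOn.sum fun σ _ =>
    ContDiffOn.const_smul _ (contDiffOn_prod fun i _ => hF _ _)

/-- Cramer's rule: the entries of the inverse are cofactors, which are again determinants of smooth
matrices, divided by the nonvanishing determinant. -/
theorem SmoothMatOn.inv (hF : SmoothMatOn F U) (h0 : ∀ u ∈ U, (F u).det ≠ 0) :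
    SmoothMatOn (fun u => (F u)⁻¹) U := by
  intro a b
  have h1 : ContDiffOn ℝ ∞ (fun u => (F u).adjugate a b) U := by
    simp only [Matrix.adjugate_apply]
    apply SmoothMatOn.det
    intro c d
    by_cases hc : c = b
    · subst hc
      simpa using contDiffOn_const
    · simpa [Matrix.updateRow_ne hc] using hF c d
  refine ((hF.det.inv h0).mul h1).congr fun u hu => ?_
  simp [Matrix.inv_def]

theorem pdMat_congr (hU : IsOpen U) (h : Set.EqOn F G U) (hu : u ∈ U) (k : Fin m) :
    pdMat k F u = pdMat k G u := by
  ext a b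
  exact pd_congr hU (fun w hw => by simp only [h hw]) hu k

theorem pdMat_add (hU : IsOpen U) (hF : SmoothMatOn F U) (hG : SmoothMatOn G U) (hu : u ∈ U)
    (k : Fin m) : pdMat k (fun w => F w + G w) u = pdMat k F u + pdMat k G u := by
  ext a b
  exact pd_add (hF.differentiableAt hU hu a b) (hG.differentiableAt hU hu a b) k

theorem pdMat_sub (hU : IsOpen U) (hF : SmoothMatOn F U) (hG : SmoothMatOn G U) (hu : u ∈ U)
    (k : Fin m) : pdMat k (fun w => F w - G w) u = pdMat k F u - pdMat k G u := by
  ext a b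
  exact pd_sub (hF.differentiableAt hU hu a b) (hG.differentiableAt hU hu a b) k

theorem pdMat_mul (hU : IsOpen U) (hF : SmoothMatOn F U) (hG : SmoothMatOn G U) (hu : u ∈ U)
    (k : Fin m) : pdMat k (fun w => F w * G w) u = pdMat k F u * G u + F u * pdMat k G u := by
  ext a b
  simp only [pdMat, Matrix.mul_apply, Matrix.of_apply, Matrix.add_apply]
  rw [pd_sum (F := fun i w => F w a i * G w i b)
    fun i _ => (hF.differentiableAt hU hu a i).mul (hG.differentiableAt hU hu i b),
    ← Finset.sum_add_distrib]
  exact Finset.sum_congr rfl fun i _ =>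
    pd_mul (hF.differentiableAt hU hu a i) (hG.differentiableAt hU hu i b) k

theorem pdMat_transpose (k : Fin m) :
    pdMat k (fun w => (F w).transpose) u = (pdMat k F u).transpose := rfl

theorem pdMat_const (A : Matrix (Fin m) (Fin m) ℝ) (k : Fin m) :
    pdMat k (fun _ => A) u = 0 := by
  ext a b
  simp [pdMat, pd]

theorem pdMat_comm (hU : IsOpen U) (hF : SmoothMatOn F U) (hu : u ∈ U) (j k : Fin m) :
    pdMat j (pdMat k F) u = pdMat k (pdMat j F) u := by
  ext a b
  exact pd_comm hU (hF a b) hu j k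

end MatrixPartials

/-! ### Curvature identities of a metric in coordinates, up to the contracted Bianchi identity. -/

section Bianchi

variable {m : ℕ} {U : Set (EuclideanSpace ℝ (Fin m))} {g : MatField m}
  {u : EuclideanSpace ℝ (Fin m)}

/-- The connection matrix `(Γ_k)^l_i = Γ^l_{ik}`. -/
noncomputable def connMat (g : MatField m) (k : Fin m) : MatField m :=
  fun u => Matrix.of fun l i => christoffel g l i k u

/-- The curvature matrix `(R_{jk})^l_i = r^l_{ijk}`. -/
noncomputable def curvMat (g : MatField m) (j k : Fin m) : MatField m :=
  fun u => Matrix.of fun l i => riemann g l i j k u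

/-- In matrix form the curvature is `∂_k Γ_j - ∂_j Γ_k + [Γ_k, Γ_j]`, so the later identities become
noncommutative algebra without index sums. -/
theorem curvMat_eq (g : MatField m) (j k : Fin m) (u : EuclideanSpace ℝ (Fin m)) :
    curvMat g j k u = pdMat k (connMat g j) u - pdMat j (connMat g k) u
      + (connMat g k u * connMat g j u - connMat g j u * connMat g k u) := by
  ext l i
  simp [curvMat, riemann, pdMat, connMat, Matrix.mul_apply, Finset.sum_sub_distrib, mul_comm]

theorem smoothMatOn_connMat (hU : IsOpen U) (hg : SmoothMatOn g U)
    (h0 : ∀ u ∈ U, (g u).det ≠ 0) (k : Fin m) : SmoothMatOn (connMat g k) U := by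
  intro l i
  simp only [connMat, christoffel, Matrix.of_apply]
  exact contDiffOn_const.mul (ContDiffOn.sum fun s _ => (hg.inv h0 l s).mul
    (((contDiffOn_pd hU (hg _ _) _).add (contDiffOn_pd hU (hg _ _) _)).sub
      (contDiffOn_pd hU (hg _ _) _)))

theorem smoothMatOn_curvMat (hU : IsOpen U) (hg : SmoothMatOn g U)
    (h0 : ∀ u ∈ U, (g u).det ≠ 0) (j k : Fin m) : SmoothMatOn (curvMat g j k) U := by
  have h := smoothMatOn_connMat hU hg h0
  have : curvMat g j k = _ := funext (curvMat_eq g j k)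
  rw [this]
  exact (((h j).pdMat hU k).sub ((h k).pdMat hU j)).add (((h k).mul (h j)).sub ((h j).mul (h k)))

theorem curvMat_antisymm (g : MatField m) (j k : Fin m) (u : EuclideanSpace ℝ (Fin m)) :
    curvMat g k j u = -curvMat g j k u := by
  rw [curvMat_eq, curvMat_eq]
  abel

/-- The second Bianchi identity for the connection matrices. -/
theorem curvMat_bianchi (hU : IsOpen U) (hg : SmoothMatOn g U)
    (h0 : ∀ u ∈ U, (g u).det ≠ 0) (hu : u ∈ U) (i j k : Fin m) :
    (pdMat i (curvMat g j k) u + (connMat g i u * curvMat g j k u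
        - curvMat g j k u * connMat g i u))
      + (pdMat j (curvMat g k i) u + (connMat g j u * curvMat g k i u
        - curvMat g k i u * connMat g j u))
      + (pdMat k (curvMat g i j) u + (connMat g k u * curvMat g i j u
        - curvMat g i j u * connMat g k u)) = 0 := by
  have h := smoothMatOn_connMat hU hg h0
  have hd (a b c : Fin m) : pdMat a (curvMat g b c) u
      = pdMat a (pdMat c (connMat g b)) u - pdMat a (pdMat b (connMat g c)) u
        + ((pdMat a (connMat g c) u * connMat g b u + connMat g c u * pdMat a (connMat g b) u)
          - (pdMat a (connMat g b) u * connMat g c u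
            + connMat g b u * pdMat a (connMat g c) u)) := by
    have : curvMat g b c = _ := funext (curvMat_eq g b c)
    rw [this, pdMat_add hU (((h b).pdMat hU c).sub ((h c).pdMat hU b))
      (((h c).mul (h b)).sub ((h b).mul (h c))) hu,
      pdMat_sub hU ((h b).pdMat hU c) ((h c).pdMat hU b) hu,
      pdMat_sub hU ((h c).mul (h b)) ((h b).mul (h c)) hu,
      pdMat_mul hU (h c) (h b) hu, pdMat_mul hU (h b) (h c) hu]
  -- Second derivatives cancel in the cyclic sum once mixed partials commute. Terms with one
  -- derivative cancel against the commutators, and cubic terms by the Jacobi identity.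
  rw [hd, hd, hd, pdMat_comm hU (h k) hu i j, pdMat_comm hU (h j) hu k i,
    pdMat_comm hU (h i) hu j k]
  simp only [curvMat_eq]
  noncomm_ring

theorem pdMat_symm (hU : IsOpen U) (hs : ∀ u ∈ U, (g u).transpose = g u) (hu : u ∈ U)
    (a b k : Fin m) : pd k (fun w => g w a b) u = pd k (fun w => g w b a) u :=
  pd_congr hU (fun w hw => congrFun (congrFun (hs w hw) b) a) hu k

theorem christoffel_symm (hU : IsOpen U) (hs : ∀ u ∈ U, (g u).transpose = g u) (hu : u ∈ U)
    (k i j : Fin m) : christoffel g k i j u = christoffel g k j i u := by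
  unfold christoffel
  congr 1
  refine Finset.sum_congr rfl fun l _ => ?_
  rw [pdMat_symm hU hs hu i j l]
  ring

/-- Compatibility of the Levi-Civita connection with the metric. -/
theorem pdMat_metric (hU : IsOpen U) (h0 : ∀ u ∈ U, (g u).det ≠ 0)
    (hs : ∀ u ∈ U, (g u).transpose = g u) (hu : u ∈ U) (k : Fin m) :
    pdMat k g u = g u * connMat g k u + (connMat g k u).transpose * g u := by
  -- Lowering the upper index cancels `g⁻¹` and leaves the Christoffel symbols of the first kind;
  -- adding the transposed symbol yields `∂_k g_{ab}`.
  have hlow (a i : Fin m) : (g u * connMat g k u) a i = 1 / 2 *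
      (pd i (fun w => g w k a) u + pd k (fun w => g w i a) u - pd a (fun w => g w i k) u) := by
    let d : Fin m → ℝ := fun a =>
      pd i (fun w => g w k a) u + pd k (fun w => g w i a) u - pd a (fun w => g w i k) u
    have h1 : (fun l => connMat g k u l i) = (1 / 2 : ℝ) • ((g u)⁻¹.mulVec d) := by
      ext l
      simp [connMat, christoffel, Matrix.mulVec, dotProduct, d]
    have h2 : (g u * connMat g k u) a i = (g u).mulVec (fun l => connMat g k u l i) a := by
      simp [Matrix.mul_apply, Matrix.mulVec, dotProduct]
    rw [h2, h1, Matrix.mulVec_smul, Matrix.mulVec_mulVec, Matrix.mul_nonsing_inv _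
      (isUnit_iff_ne_zero.2 (h0 u hu)), Matrix.one_mulVec]
    simp [d]
  have ht : (connMat g k u).transpose * g u = (g u * connMat g k u).transpose := by
    rw [Matrix.transpose_mul, hs u hu]
  ext a b
  rw [ht, Matrix.add_apply, Matrix.transpose_apply, hlow, hlow, pdMat, Matrix.of_apply,
    pdMat_symm hU hs hu k a b, pdMat_symm hU hs hu k b a, pdMat_symm hU hs hu b a k]
  ring

/-- Differentiating `g g⁻¹ = 1` and inserting metric compatibility shows that `g⁻¹` is parallel as
well. -/
theorem pdMat_inv (hU : IsOpen U) (hg : SmoothMatOn g U) (h0 : ∀ u ∈ U, (g u).det ≠ 0)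
    (hs : ∀ u ∈ U, (g u).transpose = g u) (hu : u ∈ U) (k : Fin m) :
    pdMat k (fun w => (g w)⁻¹) u
      = -(connMat g k u * (g u)⁻¹ + (g u)⁻¹ * (connMat g k u).transpose) := by
  have hinv (w) (hw : w ∈ U) : g w * (g w)⁻¹ = 1 :=
    Matrix.mul_nonsing_inv _ (isUnit_iff_ne_zero.2 (h0 w hw))
  have hinv' : (g u)⁻¹ * g u = 1 :=
    Matrix.nonsing_inv_mul _ (isUnit_iff_ne_zero.2 (h0 u hu))
  have h1 : pdMat k (fun w => g w * (g w)⁻¹) u = 0 := by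
    rw [pdMat_congr hU (G := fun _ => 1) (fun w hw => hinv w hw) hu, pdMat_const]
  rw [pdMat_mul hU hg (hg.inv h0) hu, pdMat_metric hU h0 hs hu] at h1
  have h2 := congrArg (fun A => (g u)⁻¹ * A) h1
  simp only [Matrix.mul_add, Matrix.add_mul, Matrix.mul_zero] at h2
  rw [← Matrix.mul_assoc (g u)⁻¹ (g u) (pdMat k _ u), hinv', Matrix.one_mul] at h2
  have h3 : (g u)⁻¹ * (g u * connMat g k u * (g u)⁻¹) = connMat g k u * (g u)⁻¹ := by
    rw [Matrix.mul_assoc, ← Matrix.mul_assoc, hinv', Matrix.one_mul]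
  have h4 : (g u)⁻¹ * ((connMat g k u).transpose * g u * (g u)⁻¹)
      = (g u)⁻¹ * (connMat g k u).transpose := by
    rw [Matrix.mul_assoc _ (g u), hinv u hu, Matrix.mul_one]
  rw [h3, h4] at h2
  rw [eq_neg_iff_add_eq_zero, add_comm]
  exact h2

/-- Antisymmetry of the curvature in its first two indices, once the first is lowered. -/
theorem curvMat_lower_antisymm (hU : IsOpen U) (hg : SmoothMatOn g U)
    (h0 : ∀ u ∈ U, (g u).det ≠ 0) (hs : ∀ u ∈ U, (g u).transpose = g u) (hu : u ∈ U)
    (j k : Fin m) : g u * curvMat g j k u + (curvMat g j k u).transpose * g u = 0 := by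
  have h := smoothMatOn_connMat hU hg h0
  have hd (a b : Fin m) : pdMat a (pdMat b g) u
      = (g u * connMat g a u + (connMat g a u).transpose * g u) * connMat g b u
        + g u * pdMat a (connMat g b) u
        + ((pdMat a (connMat g b) u).transpose * g u
          + (connMat g b u).transpose *
            (g u * connMat g a u + (connMat g a u).transpose * g u)) := by
    rw [pdMat_congr hU (fun w hw => pdMat_metric hU h0 hs hw b) hu,
      pdMat_add hU (hg.mul (h b)) ((h b).transpose.mul hg) hu,
      pdMat_mul hU hg (h b) hu, pdMat_mul hU (h b).transpose hg hu, pdMat_transpose,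
      pdMat_metric hU h0 hs hu]
  -- Commuting the second derivatives of `g`, expanded twice by metric compatibility, is exactly the
  -- claim: the difference of the two expansions is `g R + Rᵀ g`.
  have hc := pdMat_comm hU hg hu k j
  rw [hd, hd, ← sub_eq_zero] at hc
  rw [curvMat_eq, ← hc]
  simp only [Matrix.transpose_add, Matrix.transpose_sub, Matrix.transpose_mul]
  noncomm_ring

/-- Double contraction of the second Bianchi identity, as an identity between finite sums. -/
theorem sum_bianchi_contraction (Γ : Fin m → Fin m → Fin m → ℝ)
    (Q : Fin m → Fin m → Fin m → Fin m → ℝ) (dQ : Fin m → Fin m → Fin m → Fin m → Fin m → ℝ)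
    (hΓ : ∀ k i j, Γ k i j = Γ k j i)
    (hQ1 : ∀ j k a b, Q k j a b = -Q j k a b) (hQ2 : ∀ j k a b, Q j k b a = -Q j k a b)
    (hd1 : ∀ i j k a b, dQ i k j a b = -dQ i j k a b)
    (hd2 : ∀ i j k a b, dQ i j k b a = -dQ i j k a b)
    (hB : ∀ i j k a b,
      (dQ i j k a b + (∑ s, Γ a s i * Q j k s b + ∑ s, Γ b s i * Q j k a s))
      + (dQ j k i a b + (∑ s, Γ a s j * Q k i s b + ∑ s, Γ b s j * Q k i a s))
      + (dQ k i j a b + (∑ s, Γ a s k * Q i j s b + ∑ s, Γ b s k * Q i j a s)) = 0)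
    (j : Fin m) :
    (∑ i, ∑ k, dQ i j k k i) + (∑ i, ∑ s, ∑ k, Γ i s i * Q j k k s)
      - (∑ k, ∑ s, ∑ i, Γ k s j * Q k i i s) = 1 / 2 * ∑ k, ∑ i, dQ j k i i k := by
  have hanti (S : Fin m → Fin m → ℝ) (hS : ∀ a b, S b a = -S a b) : ∑ a, ∑ b, S a b = 0 := by
    have h1 : ∑ a, ∑ b, S a b = -∑ a, ∑ b, S a b := by
      conv_lhs => rw [Finset.sum_comm]
      simp only [← Finset.sum_neg_distrib]
      exact Finset.sum_congr rfl fun a _ => Finset.sum_congr rfl fun b _ => hS a b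
    linarith
  -- The double trace sets `a = k`, `b = i` in the cyclic identity. Write `A`, `B`, `C` for the
  -- three sums on the left of the claim. Below, `t1` and `t8` pair a symmetric `Γ` with an
  -- antisymmetric `Q` and vanish; `t6` gives a second `A`, `t2` and `t7` give `B`, `t4` and `t5`
  -- give `-C`, and `t3` gives minus the sum on the right. So `2 (A + B - C)` is that sum.
  have hsum : ∑ i, ∑ k, ((dQ i j k k i + (∑ s, Γ k s i * Q j k s i + ∑ s, Γ i s i * Q j k k s))
      + (dQ j k i k i + (∑ s, Γ k s j * Q k i s i + ∑ s, Γ i s j * Q k i k s))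
      + (dQ k i j k i + (∑ s, Γ k s k * Q i j s i + ∑ s, Γ i s k * Q i j k s))) = 0 :=
    Finset.sum_eq_zero fun i _ => Finset.sum_eq_zero fun k _ => hB i j k k i
  simp only [Finset.sum_add_distrib] at hsum
  have t1 : ∑ i, ∑ k, ∑ s, Γ k s i * Q j k s i = 0 := by
    rw [Finset.sum_comm]
    exact Finset.sum_eq_zero fun k _ => hanti (fun i s => Γ k s i * Q j k s i) fun i s => by
      rw [hΓ, hQ2]; ring
  have t2 : ∑ i, ∑ k, ∑ s, Γ i s i * Q j k k s = ∑ i, ∑ s, ∑ k, Γ i s i * Q j k k s :=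
    Finset.sum_congr rfl fun i _ => Finset.sum_comm
  have t3 : ∑ i, ∑ k, dQ j k i k i = -∑ k, ∑ i, dQ j k i i k := by
    rw [Finset.sum_comm]
    simp only [← Finset.sum_neg_distrib]
    exact Finset.sum_congr rfl fun a _ => Finset.sum_congr rfl fun b _ => hd2 _ _ _ _ _
  have t4 : ∑ i, ∑ k, ∑ s, Γ k s j * Q k i s i = -∑ k, ∑ s, ∑ i, Γ k s j * Q k i i s := by
    rw [Finset.sum_comm]
    simp only [← Finset.sum_neg_distrib]
    refine Finset.sum_congr rfl fun k _ => ?_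
    rw [Finset.sum_comm]
    exact Finset.sum_congr rfl fun a _ => Finset.sum_congr rfl fun b _ => by rw [hQ2]; ring
  have t5 : ∑ i, ∑ k, ∑ s, Γ i s j * Q k i k s = -∑ k, ∑ s, ∑ i, Γ k s j * Q k i i s := by
    simp only [← Finset.sum_neg_distrib]
    refine Finset.sum_congr rfl fun k _ => ?_
    rw [Finset.sum_comm]
    exact Finset.sum_congr rfl fun a _ => Finset.sum_congr rfl fun b _ => by rw [hQ1]; ring
  have t6 : ∑ i, ∑ k, dQ k i j k i = ∑ i, ∑ k, dQ i j k k i := by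
    rw [Finset.sum_comm]
    exact Finset.sum_congr rfl fun a _ => Finset.sum_congr rfl fun b _ => by rw [hd1, hd2]; ring
  have t7 : ∑ i, ∑ k, ∑ s, Γ k s k * Q i j s i = ∑ i, ∑ s, ∑ k, Γ i s i * Q j k k s := by
    rw [Finset.sum_comm]
    refine Finset.sum_congr rfl fun k _ => ?_
    rw [Finset.sum_comm]
    exact Finset.sum_congr rfl fun a _ => Finset.sum_congr rfl fun b _ => by rw [hQ1, hQ2]; ring
  have t8 : ∑ i, ∑ k, ∑ s, Γ i s k * Q i j k s = 0 :=
    Finset.sum_eq_zero fun i _ => hanti (fun k s => Γ i s k * Q i j k s) fun k s => by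
      rw [hΓ, hQ2]; ring
  rw [t1, t2, t3, t4, t5, t6, t7, t8] at hsum
  linarith

/-- Mixed Ricci tensor `r^a_b = g^{ac} r_{cb}`. -/
noncomputable def ricciMixed (g : MatField m) (a b : Fin m) (u : EuclideanSpace ℝ (Fin m)) : ℝ :=
  ∑ c, (g u)⁻¹ a c * ricci g c b u

/-- The mixed Ricci tensor is a trace of `R g⁻¹`, the matrix whose covariant derivative and
antisymmetry are under control in the contracted Bianchi identity. -/
theorem ricciMixed_eq (hs : (g u).transpose = g u) (a b : Fin m) :
    ricciMixed g a b u = ∑ s, (curvMat g b s u * (g u)⁻¹) s a := by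
  have hP (c : Fin m) : (g u)⁻¹ a c = (g u)⁻¹ c a := by
    conv_rhs => rw [← hs, ← Matrix.transpose_nonsing_inv, Matrix.transpose_apply]
  simp only [ricciMixed, ricci, Matrix.mul_apply, curvMat, Matrix.of_apply, Finset.mul_sum]
  rw [Finset.sum_comm]
  exact Finset.sum_congr rfl fun s _ => Finset.sum_congr rfl fun c _ => by rw [hP, mul_comm]

theorem scalarCurv_eq_sum_ricciMixed (hs : (g u).transpose = g u) :
    scalarCurv g u = ∑ a, ricciMixed g a a u := by
  have hP (a c : Fin m) : (g u)⁻¹ a c = (g u)⁻¹ c a := by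
    conv_rhs => rw [← hs, ← Matrix.transpose_nonsing_inv, Matrix.transpose_apply]
  simp only [scalarCurv, ricciMixed]
  rw [Finset.sum_comm]
  exact Finset.sum_congr rfl fun s _ => Finset.sum_congr rfl fun c _ => by rw [hP]

theorem contDiffOn_ricciMixed (hU : IsOpen U) (hg : SmoothMatOn g U)
    (h0 : ∀ u ∈ U, (g u).det ≠ 0) (a b : Fin m) : ContDiffOn ℝ ∞ (ricciMixed g a b) U :=
  ContDiffOn.sum fun c _ => (hg.inv h0 a c).mul
    (ContDiffOn.sum fun s _ => smoothMatOn_curvMat hU hg h0 b s s c)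

/-- The contracted Bianchi identity: the divergence of the Ricci tensor is half the differential
of the scalar curvature. -/
theorem contracted_bianchi (hU : IsOpen U) (hg : SmoothMatOn g U) (h0 : ∀ u ∈ U, (g u).det ≠ 0)
    (hs : ∀ u ∈ U, (g u).transpose = g u) (hu : u ∈ U) (j : Fin m) :
    ∑ i, (pd i (ricciMixed g i j) u + ∑ s, (christoffel g i s i u * ricciMixed g s j u
      - christoffel g s j i u * ricciMixed g i s u)) = 1 / 2 * pd j (scalarCurv g) u := by
  -- Raising the second matrix index makes `Q_{jk}` antisymmetric in its matrix indices as well as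
  -- in `j, k`.
  let Q : Fin m → Fin m → MatField m := fun j k w => curvMat g j k w * (g w)⁻¹
  have hR := smoothMatOn_curvMat hU hg h0
  have hQs (j k) : SmoothMatOn (Q j k) U := (hR j k).mul (hg.inv h0)
  have hQ1 (w) (j k : Fin m) : Q k j w = -Q j k w := by
    simp only [Q, curvMat_antisymm g j k, Matrix.neg_mul]
  have hinv (w) (hw : w ∈ U) : g w * (g w)⁻¹ = 1 :=
    Matrix.mul_nonsing_inv _ (isUnit_iff_ne_zero.2 (h0 w hw))
  have hinv' (w) (hw : w ∈ U) : (g w)⁻¹ * g w = 1 :=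
    Matrix.nonsing_inv_mul _ (isUnit_iff_ne_zero.2 (h0 w hw))
  have hQ2 (w) (hw : w ∈ U) (j k : Fin m) : (Q j k w).transpose = -Q j k w := by
    have h1 := curvMat_lower_antisymm hU hg h0 hs hw j k
    have h2 := congrArg (fun A => (g w)⁻¹ * A * (g w)⁻¹) h1
    simp only [Matrix.mul_add, Matrix.add_mul, Matrix.mul_zero, Matrix.zero_mul] at h2
    rw [← Matrix.mul_assoc (g w)⁻¹ (g w), hinv' w hw, Matrix.one_mul, Matrix.mul_assoc (g w)⁻¹,
      Matrix.mul_assoc _ (g w), hinv w hw, Matrix.mul_one] at h2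
    simp only [Q, Matrix.transpose_mul]
    rw [Matrix.transpose_nonsing_inv, hs w hw, eq_neg_iff_add_eq_zero, add_comm]
    exact h2
  -- Since `g⁻¹` is parallel, the covariant derivative of `R g⁻¹` is that of `R` times `g⁻¹`, and
  -- the second Bianchi identity carries over to `Q`.
  have hdQ (i j k : Fin m) : pdMat i (Q j k) u + (connMat g i u * Q j k u
      + Q j k u * (connMat g i u).transpose)
      = (pdMat i (curvMat g j k) u + (connMat g i u * curvMat g j k u
        - curvMat g j k u * connMat g i u)) * (g u)⁻¹ := by
    simp only [Q]
    rw [pdMat_mul hU (hR j k) (hg.inv h0) hu, pdMat_inv hU hg h0 hs hu]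
    noncomm_ring
  have hB (i j k : Fin m) :
      (pdMat i (Q j k) u + (connMat g i u * Q j k u + Q j k u * (connMat g i u).transpose))
      + (pdMat j (Q k i) u + (connMat g j u * Q k i u + Q k i u * (connMat g j u).transpose))
      + (pdMat k (Q i j) u + (connMat g k u * Q i j u + Q i j u * (connMat g k u).transpose))
      = 0 := by
    rw [hdQ, hdQ, hdQ, ← Matrix.add_mul, ← Matrix.add_mul, curvMat_bianchi hU hg h0 hu,
      Matrix.zero_mul]
  have key := sum_bianchi_contraction (fun k i j => christoffel g k i j u)
    (fun j k a b => Q j k u a b) (fun i j k a b => pdMat i (Q j k) u a b)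
    (fun k i j => christoffel_symm hU hs hu k i j)
    (fun j k a b => by rw [hQ1]; rfl)
    (fun j k a b => congrFun (congrFun (hQ2 u hu j k) a) b)
    (fun i j k a b => by
      have : Q k j = fun w => -Q j k w := funext fun w => hQ1 w j k
      simp only [this]
      exact pd_neg i)
    (fun i j k a b => by
      rw [← Matrix.transpose_apply (pdMat i (Q j k) u), ← pdMat_transpose,
        pdMat_congr hU (fun w hw => hQ2 w hw j k) hu]
      exact pd_neg i)
    (fun i j k a b => by
      have := congrFun (congrFun (hB i j k) a) b
      simpa [Matrix.mul_apply, connMat, mul_comm] using this) j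
  have hmix (a b : Fin m) : Set.EqOn (ricciMixed g a b) (fun w => ∑ s, Q b s w s a) U :=
    fun w hw => ricciMixed_eq (hs w hw) a b
  have hpd (i a b : Fin m) : pd i (ricciMixed g a b) u = ∑ s, pdMat i (Q b s) u s a := by
    rw [pd_congr hU (hmix a b) hu, pd_sum fun s _ => (hQs b s).differentiableAt hU hu s a]
    rfl
  have hsc : pd j (scalarCurv g) u = ∑ k, ∑ i, pdMat j (Q k i) u i k := by
    rw [pd_congr hU (fun w hw => scalarCurv_eq_sum_ricciMixed (hs w hw)) hu,
      pd_sum fun s _ => differentiableAt_of_contDiffOn hU (contDiffOn_ricciMixed hU hg h0 s s) hu]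
    exact Finset.sum_congr rfl fun k _ => hpd j k k
  rw [hsc, ← key]
  simp only [Finset.sum_add_distrib, Finset.sum_sub_distrib, hpd, ← Finset.mul_sum]
  rw [add_sub_assoc]
  congr 2
  · exact Finset.sum_congr rfl fun i _ => Finset.sum_congr rfl fun s _ => by rw [hmix _ _ hu]
  · rw [Finset.sum_comm]
    exact Finset.sum_congr rfl fun i _ => Finset.sum_congr rfl fun s _ => by
      rw [hmix _ _ hu, christoffel_symm hU hs hu]

end Bianchi

/-- Local data of a least squares Lagrangian `L = h^{αβ} φ_{ij} (x^i_α - X^i_α) (x^j_β - X^j_β)`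
over `U × V`. -/
structure IsLocalLeastSquares {p n : ℕ} (U : Set (EuclideanSpace ℝ (Fin p)))
    (V : Set (EuclideanSpace ℝ (Fin n))) (h : MatField p) (φ : MatField n) (X : FieldComp p n)
    (L : JetCoord p n → ℝ) : Prop where
  isOpen_time : IsOpen U
  isOpen_space : IsOpen V
  smooth_h : SmoothMatOn h U
  smooth_φ : SmoothMatOn φ V
  posDef_h : ∀ u ∈ U, (h u).PosDef
  posDef_φ : ∀ y ∈ V, (φ y).PosDef
  smooth_X : ∀ i α, ContDiffOn ℝ ∞
    (fun q : EuclideanSpace ℝ (Fin p) × EuclideanSpace ℝ (Fin n) => X q.1 q.2 i α) (U ×ˢ V)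
  eq_sum : ∀ z : JetCoord p n, z.1 ∈ U → z.2.1 ∈ V → L z =
    ∑ α, ∑ β, ∑ i, ∑ j, (h z.1)⁻¹ α β * φ z.2.1 i j
      * (z.2.2 i α - X z.1 z.2.1 i α) * (z.2.2 j β - X z.1 z.2.1 j β)

/-- The part of the jet coordinate space over `U × V`. -/
def jetOver {p n : ℕ} (U : Set (EuclideanSpace ℝ (Fin p))) (V : Set (EuclideanSpace ℝ (Fin n))) :
    Set (JetCoord p n) :=
  {z | z.1 ∈ U ∧ z.2.1 ∈ V}

theorem isOpen_jetOver {p n : ℕ} {U : Set (EuclideanSpace ℝ (Fin p))}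
    {V : Set (EuclideanSpace ℝ (Fin n))} (hU : IsOpen U) (hV : IsOpen V) :
    IsOpen (jetOver U V) :=
  (hU.preimage continuous_fst).inter (hV.preimage (continuous_fst.comp continuous_snd))

/-! ### Derivatives, brackets and curvature in an adapted frame. -/

section FrameCalculus

variable {p n : ℕ} (Γ : NonlinearConnection p n)

theorem fderiv_comp_time {F : EuclideanSpace ℝ (Fin p) → ℝ} {z : JetCoord p n}
    (hF : DifferentiableAt ℝ F z.1) (v : JetCoord p n) :
    fderiv ℝ (fun w : JetCoord p n => F w.1) z v = fderiv ℝ F z.1 v.1 := by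
  have := hF.hasFDerivAt.comp z (hasFDerivAt_fst (𝕜 := ℝ) (p := z))
  rw [show (fun w : JetCoord p n => F w.1) = F ∘ Prod.fst from rfl, this.fderiv]
  rfl

theorem fderiv_comp_space {F : EuclideanSpace ℝ (Fin n) → ℝ} {z : JetCoord p n}
    (hF : DifferentiableAt ℝ F z.2.1) (v : JetCoord p n) :
    fderiv ℝ (fun w : JetCoord p n => F w.2.1) z v = fderiv ℝ F z.2.1 v.2.1 := by
  have h1 : HasFDerivAt (fun w : JetCoord p n => w.2.1) _ z :=
    (hasFDerivAt_fst (𝕜 := ℝ) (p := z.2)).comp z (hasFDerivAt_snd (𝕜 := ℝ) (p := z))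
  have := HasFDerivAt.comp (g := F) z hF.hasFDerivAt h1
  rw [show (fun w : JetCoord p n => F w.2.1) = F ∘ (fun w => w.2.1) from rfl, this.fderiv]
  rfl

theorem frameDeriv_comp_time {F : EuclideanSpace ℝ (Fin p) → ℝ} {z : JetCoord p n}
    (hF : DifferentiableAt ℝ F z.1) (A : AIdx p n) :
    frameDeriv Γ A (fun w => F w.1) z = Sum.elim (fun α => pd α F z.1) (fun _ => 0) A := by
  rw [frameDeriv, fderiv_comp_time hF]
  rcases A with α | i | ⟨i, α⟩ <;> simp [frame, vert, pd]

theorem frameDeriv_comp_space {F : EuclideanSpace ℝ (Fin n) → ℝ} {z : JetCoord p n}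
    (hF : DifferentiableAt ℝ F z.2.1) (A : AIdx p n) :
    frameDeriv Γ A (fun w => F w.2.1) z
      = Sum.elim (fun _ => 0) (Sum.elim (fun i => pd i F z.2.1) (fun _ => 0)) A := by
  rw [frameDeriv, fderiv_comp_space hF]
  rcases A with α | i | ⟨i, α⟩ <;> simp [frame, vert, pd]

theorem frameDeriv_const (A : AIdx p n) (c : ℝ) (z : JetCoord p n) :
    frameDeriv Γ A (fun _ => c) z = 0 := by
  simp [frameDeriv]

theorem frameDeriv_congr {W : Set (JetCoord p n)} (hW : IsOpen W) {F G : JetCoord p n → ℝ}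
    (h : Set.EqOn F G W) {z : JetCoord p n} (hz : z ∈ W) (A : AIdx p n) :
    frameDeriv Γ A F z = frameDeriv Γ A G z := by
  unfold frameDeriv
  rw [Filter.EventuallyEq.fderiv_eq (Filter.eventually_of_mem (hW.mem_nhds hz) h)]

theorem coframe_frame (C A : AIdx p n) (z : JetCoord p n) :
    coframe Γ C z (frame Γ A z) = if C = A then 1 else 0 := by
  rcases C with γ | k | ⟨k, γ⟩ <;> rcases A with α | i | ⟨i, α⟩ <;>
    simp [coframe, frame, deltaX, vert, Prod.ext_iff]

/-- A coframe element at a point, as a linear form. -/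
def coframeLin (C : AIdx p n) (z : JetCoord p n) : JetCoord p n →ₗ[ℝ] ℝ where
  toFun := coframe Γ C z
  map_add' v w := by
    rcases C with γ | k | ⟨k, γ⟩ <;>
      simp [coframe, deltaX, mul_add, Finset.sum_add_distrib]
    ring
  map_smul' c v := by
    rcases C with γ | k | ⟨k, γ⟩ <;>
      simp [coframe, deltaX, mul_add, Finset.mul_sum, mul_left_comm]

theorem coframe_sub (C : AIdx p n) (z v w : JetCoord p n) :
    coframe Γ C z (v - w) = coframe Γ C z v - coframe Γ C z w :=
  map_sub (coframeLin Γ C z) v w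

theorem coframe_sum_frame (D : AIdx p n) (z : JetCoord p n) (a : AIdx p n → ℝ) :
    coframe Γ D z (∑ C, a C • frame Γ C z) = a D := by
  change coframeLin Γ D z _ = _
  rw [map_sum]
  simp only [map_smul, smul_eq_mul]
  change ∑ C, a C * coframe Γ D z (frame Γ C z) = a D
  simp [coframe_frame]

theorem coframe_covDeriv (conn : ConnCoeff p n) (D : AIdx p n)
    (V Y : JetCoord p n → JetCoord p n) (z : JetCoord p n) :
    coframe Γ D z (covDeriv Γ conn V Y z) = fderiv ℝ (fun w => coframe Γ D w (Y w)) z (V z)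
      + ∑ A, ∑ B, conn D A B z * coframe Γ A z (Y z) * coframe Γ B z (V z) :=
  coframe_sum_frame Γ D z _

theorem coframe_covDeriv_frame (conn : ConnCoeff p n) (D A : AIdx p n)
    (V : JetCoord p n → JetCoord p n) (z : JetCoord p n) :
    coframe Γ D z (covDeriv Γ conn V (frame Γ A) z) = ∑ B, conn D A B z * coframe Γ B z (V z) := by
  rw [coframe_covDeriv]
  simp [coframe_frame]

theorem coframe_covDeriv_frame_frame (conn : ConnCoeff p n) (D A B : AIdx p n)
    (z : JetCoord p n) :
    coframe Γ D z (covDeriv Γ conn (frame Γ B) (frame Γ A) z) = conn D A B z := by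
  rw [coframe_covDeriv_frame]
  simp [coframe_frame]

/-- The frame components of `D_{X_B} X_A` are the coefficient functions themselves, so a second
covariant derivative adds one derivative term and one quadratic term. -/
theorem coframe_covDeriv_covDeriv (conn : ConnCoeff p n) (D A B C : AIdx p n)
    (z : JetCoord p n) :
    coframe Γ D z (covDeriv Γ conn (frame Γ C) (covDeriv Γ conn (frame Γ B) (frame Γ A)) z)
      = frameDeriv Γ C (conn D A B) z + ∑ E, conn D E C z * conn E A B z := by
  rw [coframe_covDeriv]
  simp only [coframe_covDeriv_frame_frame, coframe_frame, frameDeriv]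
  simp

/-- The `t` and `x` components of a frame field are constant. If the field is not differentiable,
`fderiv` is zero by convention, so no regularity of `M` and `N` is needed. -/
theorem fderiv_frame_horizontal (A : AIdx p n) (z v : JetCoord p n) :
    (fderiv ℝ (frame Γ A) z v).1 = 0 ∧ (fderiv ℝ (frame Γ A) z v).2.1 = 0 := by
  by_cases hd : DifferentiableAt ℝ (frame Γ A) z
  · have h1 := (hasFDerivAt_fst (𝕜 := ℝ) (p := frame Γ A z)).comp z hd.hasFDerivAt
    have h2 : HasFDerivAt (fun w : JetCoord p n => w.2.1) _ (frame Γ A z) :=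
      (hasFDerivAt_fst (𝕜 := ℝ) (p := (frame Γ A z).2)).comp _
        (hasFDerivAt_snd (𝕜 := ℝ) (p := frame Γ A z))
    have h3 := HasFDerivAt.comp z h2 hd.hasFDerivAt
    constructor
    · have : (Prod.fst ∘ frame Γ A) = fun _ => (frame Γ A z).1 := by
        ext1 w
        rcases A with α | i | ⟨i, α⟩ <;> rfl
      rw [this] at h1
      exact congrArg (fun l => l v) (h1.unique (hasFDerivAt_const _ _))
    · have : ((fun w : JetCoord p n => w.2.1) ∘ frame Γ A) = fun _ => (frame Γ A z).2.1 := by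
        ext1 w
        rcases A with α | i | ⟨i, α⟩ <;> rfl
      rw [this] at h3
      exact congrArg (fun l => l v) (h3.unique (hasFDerivAt_const _ _))
  · simp [fderiv_zero_of_not_differentiableAt hd]

/-- The bracket is a difference of derivatives of frame fields, both vertical: the nonholonomy of
the frame is purely vertical. -/
theorem coframe_lieBracket_frame (C B : AIdx p n) (z : JetCoord p n) :
    (∀ α, coframe Γ (.inl α) z (VectorField.lieBracket ℝ (frame Γ C) (frame Γ B) z) = 0) ∧
    ∀ i, coframe Γ (.inr (.inl i)) z
      (VectorField.lieBracket ℝ (frame Γ C) (frame Γ B) z) = 0 := by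
  constructor
  · intro α
    simp [coframe, VectorField.lieBracket, (fderiv_frame_horizontal Γ _ _ _).1]
  · intro i
    simp [coframe, VectorField.lieBracket, (fderiv_frame_horizontal Γ _ _ _).2]

/-- Curvature components in the adapted frame, for a connection that is trivial along the vertical
directions. -/
theorem coframe_curvature (conn : ConnCoeff p n) (z : JetCoord p n)
    (hv : ∀ D A j γ, conn D A (.inr (.inr (j, γ))) z = 0) (D A B C : AIdx p n) :
    coframe Γ D z (curvature Γ conn (frame Γ C) (frame Γ B) (frame Γ A) z)
      = frameDeriv Γ C (conn D A B) z - frameDeriv Γ B (conn D A C) z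
        + ((∑ E, conn D E C z * conn E A B z) - ∑ E, conn D E B z * conn E A C z) := by
  rw [curvature, coframe_sub, coframe_sub, coframe_covDeriv_covDeriv, coframe_covDeriv_covDeriv,
    coframe_covDeriv_frame]
  -- In the bracket term each summand has a zero factor: the coframe component for horizontal
  -- directions, the connection coefficient for vertical ones.
  simp only [Fintype.sum_sum_type, Fintype.sum_prod_type, hv,
    (coframe_lieBracket_frame Γ C B z).1, (coframe_lieBracket_frame Γ C B z).2]
  simp
  ring

end FrameCalculus

/-! ### Ricci tensor of the connection induced by two Levi-Civita connections. -/

section BaseConnection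

variable {p n : ℕ}

/-- The linear connection induced in an adapted frame by the Levi-Civita connections of a pair of
metrics. -/
noncomputable def baseConn (h : MatField p) (φ : MatField n) : ConnCoeff p n
  | .inl α, .inl β, .inl γ => fun z => christoffel h α β γ z.1
  | .inr (.inl k), .inr (.inl i), .inr (.inl j) => fun z => christoffel φ k i j z.2.1
  | .inr (.inr (k, β)), .inr (.inr (i, α)), .inl γ =>
      if k = i then fun z => -christoffel h α β γ z.1 else fun _ => 0
  | .inr (.inr (k, β)), .inr (.inr (i, α)), .inr (.inl j) =>
      if α = β then fun z => christoffel φ k i j z.2.1 else fun _ => 0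
  | _, _, _ => fun _ => 0

/-- The Ricci tensors of a pair of metrics, as a block matrix in an adapted frame. -/
noncomputable def baseRicci (h : MatField p) (φ : MatField n) (z : JetCoord p n) :
    AIdx p n → AIdx p n → ℝ
  | .inl α, .inl β => ricci h α β z.1
  | .inr (.inl i), .inr (.inl j) => ricci φ i j z.2.1
  | _, _ => 0

/-- The coefficients never mix blocks and each depends on `t` alone or on `x` alone. The contraction
therefore gives the classical Ricci tensor on each horizontal diagonal block and nothing elsewhere.
-/
theorem sum_curvature_baseConn (Γ : NonlinearConnection p n) {h : MatField p} {φ : MatField n}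
    {z : JetCoord p n} (hh : ∀ α β γ, DifferentiableAt ℝ (christoffel h α β γ) z.1)
    (hφ : ∀ i j k, DifferentiableAt ℝ (christoffel φ i j k) z.2.1) (A B : AIdx p n) :
    ∑ D, (frameDeriv Γ D (baseConn h φ D A B) z - frameDeriv Γ B (baseConn h φ D A D) z
        + ((∑ E, baseConn h φ D E D z * baseConn h φ E A B z)
          - ∑ E, baseConn h φ D E B z * baseConn h φ E A D z))
      = baseRicci h φ z A B := by
  have hnh (α β γ) (D : AIdx p n) : frameDeriv Γ D (fun z => -christoffel h α β γ z.1) z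
      = Sum.elim (fun δ => pd δ (fun w => -christoffel h α β γ w) z.1) (fun _ => 0) D :=
    frameDeriv_comp_time Γ (F := fun w => -christoffel h α β γ w) (hh α β γ).neg D
  have h1 (α β γ) (D : AIdx p n) := frameDeriv_comp_time Γ (hh α β γ) D
  have h2 (i j k) (D : AIdx p n) := frameDeriv_comp_space Γ (hφ i j k) D
  rcases A with α | i | ⟨i, α⟩ <;> rcases B with β | j | ⟨j, β⟩ <;>
    simp only [Fintype.sum_sum_type, Fintype.sum_prod_type, baseConn, baseRicci,
      frameDeriv_const, h1, h2, Sum.elim_inl, Sum.elim_inr, mul_zero, zero_mul,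
      Finset.sum_const_zero, add_zero, zero_add, sub_zero, sub_self, zero_sub,
      neg_zero]
  · refine Finset.sum_congr rfl fun s _ => ?_
    simp only [riemann, Finset.sum_sub_distrib, mul_comm]
  · refine Finset.sum_congr rfl fun s _ => ?_
    simp only [riemann, Finset.sum_sub_distrib, mul_comm]
  -- For vertical `A` what remains is the derivative, along vertical `D`, of functions of `t` (here)
  -- or of `x` (next case), which is zero.
  · refine Finset.sum_eq_zero fun k _ => Finset.sum_eq_zero fun δ _ => ?_
    split_ifs <;> simp [hnh, frameDeriv_const]
  · refine Finset.sum_eq_zero fun k _ => Finset.sum_eq_zero fun δ _ => ?_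
    split_ifs <;> simp [h2, frameDeriv_const]

/-- Curvature differentiates the coefficients, so agreement is required on an open set and not only
at the point. -/
theorem ricciD_eq_baseRicci (Γ : NonlinearConnection p n) {h : MatField p} {φ : MatField n}
    {conn : ConnCoeff p n} {W : Set (JetCoord p n)} (hW : IsOpen W)
    (hc : ∀ D A B, Set.EqOn (conn D A B) (baseConn h φ D A B) W) {z : JetCoord p n} (hz : z ∈ W)
    (hh : ∀ α β γ, DifferentiableAt ℝ (christoffel h α β γ) z.1)
    (hφ : ∀ i j k, DifferentiableAt ℝ (christoffel φ i j k) z.2.1) (A B : AIdx p n) :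
    ricciD Γ conn A B z = baseRicci h φ z A B := by
  have hv (D A : AIdx p n) (j γ) : conn D A (.inr (.inr (j, γ))) z = 0 := by
    rw [hc _ _ _ hz]
    rcases D with α | i | ⟨i, α⟩ <;> rcases A with β | k | ⟨k, β⟩ <;> rfl
  rw [← sum_curvature_baseConn Γ hh hφ]
  refine Finset.sum_congr rfl fun D _ => ?_
  rw [coframe_curvature Γ conn z hv]
  simp only [frameDeriv_congr Γ hW (hc _ _ _) hz, hc _ _ _ hz]

end BaseConnection

/-! ### Coordinate frames and metric components in a chart of the maximal atlas. -/

section ChartFrames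

variable {m : ℕ} {B : Type*} [TopologicalSpace B] [ChartedSpace (EuclideanSpace ℝ (Fin m)) B]
  [IsManifold (𝓡 m) ∞ B] {e : OpenPartialHomeomorph B (EuclideanSpace ℝ (Fin m))}

omit [IsManifold (𝓡 m) ∞ B] in
theorem mdifferentiable_of_mem_maximalAtlas (he : e ∈ IsManifold.maximalAtlas (𝓡 m) ∞ B) :
    e.MDifferentiable (𝓡 m) (𝓡 m) :=
  ⟨(contMDiffOn_of_mem_maximalAtlas he).mdifferentiableOn (by simp),
    (contMDiffOn_symm_of_mem_maximalAtlas he).mdifferentiableOn (by simp)⟩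

omit [IsManifold (𝓡 m) ∞ B] in
theorem coordForm_coordVec (he : e ∈ IsManifold.maximalAtlas (𝓡 m) ∞ B)
    {u : EuclideanSpace ℝ (Fin m)} (hu : u ∈ e.target) (a b : Fin m) :
    coordForm e a (e.symm u) (coordVec e b u) = if a = b then 1 else 0 := by
  have h := (mdifferentiable_of_mem_maximalAtlas he).comp_symm_deriv hu
  have h2 := congrArg (fun l => l (EuclideanSpace.single b (1 : ℝ) : EuclideanSpace ℝ (Fin m))) h
  have h3 : mfderiv (𝓡 m) (𝓡 m) e (e.symm u) (coordVec e b u)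
    = (EuclideanSpace.single b (1 : ℝ) : EuclideanSpace ℝ (Fin m)) := h2
  calc coordForm e a (e.symm u) (coordVec e b u)
      = (EuclideanSpace.proj a : EuclideanSpace ℝ (Fin m) →L[ℝ] ℝ)
          (mfderiv (𝓡 m) (𝓡 m) e (e.symm u) (coordVec e b u)) := rfl
    _ = (EuclideanSpace.proj a : EuclideanSpace ℝ (Fin m) →L[ℝ] ℝ)
          (EuclideanSpace.single b (1 : ℝ)) := by rw [h3]
    _ = _ := by simp

theorem euclidean_sum_single (v : EuclideanSpace ℝ (Fin m)) :
    v = ∑ a, v a • (EuclideanSpace.single a (1 : ℝ) : EuclideanSpace ℝ (Fin m)) := by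
  have := (EuclideanSpace.basisFun (Fin m) ℝ).sum_repr v
  simpa using this.symm

omit [IsManifold (𝓡 m) ∞ B] in
theorem sum_coordForm_smul_coordVec (he : e ∈ IsManifold.maximalAtlas (𝓡 m) ∞ B)
    {u : EuclideanSpace ℝ (Fin m)} (hu : u ∈ e.target) (v : TangentSpace (𝓡 m) (e.symm u)) :
    v = ∑ a, coordForm e a (e.symm u) v • coordVec e a u := by
  have h := (mdifferentiable_of_mem_maximalAtlas he).symm_comp_deriv (e.map_target hu)
  have h2 := congrArg (fun l => l v) h
  rw [e.right_inv hu] at h2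
  have h3 : mfderiv (𝓡 m) (𝓡 m) e.symm u (mfderiv (𝓡 m) (𝓡 m) e (e.symm u) v) = v := h2
  conv_lhs => rw [← h3]
  let w : EuclideanSpace ℝ (Fin m) := mfderiv (𝓡 m) (𝓡 m) e (e.symm u) v
  have h4 := euclidean_sum_single w
  let l : EuclideanSpace ℝ (Fin m) →L[ℝ] TangentSpace (𝓡 m) (e.symm u) :=
    mfderiv (𝓡 m) (𝓡 m) e.symm u
  change l w = ∑ a, w a • l (EuclideanSpace.single a 1)
  conv_lhs => rw [h4]
  simp only [map_sum, map_smul]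

/-- The coordinate field is the tangent map of `e.symm` applied to a constant section of the tangent
bundle of the model space. -/
theorem contMDiffOn_coordVec (he : e ∈ IsManifold.maximalAtlas (𝓡 m) ∞ B) (a : Fin m) :
    ContMDiffOn (𝓡 m) (𝓡 m).tangent ∞
      (fun u => (⟨e.symm u, coordVec e a u⟩ : TangentBundle (𝓡 m) B)) e.target := by
  have h1 := (contMDiffOn_symm_of_mem_maximalAtlas he).contMDiffOn_tangentMapWithin
    (m := ∞) (by simp) e.open_target.uniqueMDiffOn
  have h2 : ContMDiff (𝓡 m) (𝓡 m).tangent ∞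
      (fun u : EuclideanSpace ℝ (Fin m) => (⟨u, (EuclideanSpace.single a (1 : ℝ) :
        EuclideanSpace ℝ (Fin m))⟩ : TangentBundle (𝓡 m) (EuclideanSpace ℝ (Fin m)))) := by
    exact contMDiff_vectorSpace_iff_contDiff.2 contDiff_const
  refine (h1.comp (s := e.target) h2.contMDiffOn (fun u hu => hu)).congr fun u hu => ?_
  simp only [Function.comp, tangentMapWithin, coordVec]
  rw [mfderivWithin_of_isOpen e.open_target hu]

theorem contDiffOn_metricComp (he : e ∈ IsManifold.maximalAtlas (𝓡 m) ∞ B) (g : RiemMetric m B)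
    (a b : Fin m) : ContDiffOn ℝ ∞ (fun u => metricComp g e u a b) e.target := by
  rw [← contMDiffOn_iff_contDiffOn]
  -- Real values are viewed in the trivial line bundle, so that the metric, a smooth section of
  -- bilinear forms, can be evaluated on two smooth sections.
  have h : ContMDiffOn (𝓡 m) ((𝓡 m).prod 𝓘(ℝ)) ∞
      (fun u => Bundle.TotalSpace.mk' ℝ (E := Bundle.Trivial B ℝ) (e.symm u)
        (g.inner (e.symm u) (coordVec e a u) (coordVec e b u))) e.target := by
    apply ContMDiffOn.clm_bundle_apply₂ (F₁ := EuclideanSpace ℝ (Fin m))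
      (F₂ := EuclideanSpace ℝ (Fin m))
    · exact g.contMDiff.comp_contMDiffOn (contMDiffOn_symm_of_mem_maximalAtlas he)
    · exact contMDiffOn_coordVec he a
    · exact contMDiffOn_coordVec he b
  intro u hu
  have := h u hu
  simp only [Bundle.contMDiffWithinAt_totalSpace] at this
  exact this.2

theorem posDef_metricComp (he : e ∈ IsManifold.maximalAtlas (𝓡 m) ∞ B) (g : RiemMetric m B)
    {u : EuclideanSpace ℝ (Fin m)} (hu : u ∈ e.target) : (metricComp g e u).PosDef := by
  refine Matrix.PosDef.of_dotProduct_mulVec_pos ?_ ?_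
  · ext a b
    simp [metricComp, g.symm]
  · intro x hx
    have h0 : (∑ a, x a • coordVec e a u) ≠ 0 := by
      intro h
      apply hx
      ext b
      have := congrArg (coordForm e b (e.symm u)) h
      simpa [coordForm_coordVec he hu] using this
    have := g.pos _ _ h0
    rw [dotProduct]
    simp only [map_sum, map_smul, sum_apply, Finset.smul_sum] at this
    rw [Finset.sum_comm] at this
    simpa [metricComp, Matrix.mulVec, dotProduct, Finset.mul_sum, mul_comm, mul_left_comm,
      mul_assoc] using this

end ChartFrames


/-- The contraction of the inverse of a Gram matrix with a second Gram matrix is unchanged by a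
change of basis. -/
theorem sum_inv_mul_congruence {p : ℕ} (A A' H C : Matrix (Fin p) (Fin p) ℝ) (hA : A' * A = 1) :
    ∑ α, ∑ β, (A.transpose * H * A)⁻¹ α β * (A.transpose * C * A) α β
      = ∑ α, ∑ β, H⁻¹ α β * C α β := by
  have hA2 : A * A' = 1 := mul_eq_one_comm.1 hA
  -- Both contractions become traces, where cyclicity cancels `A` against its inverse.
  have key (S R : Matrix (Fin p) (Fin p) ℝ) :
      ∑ α, ∑ β, S α β * R α β = (S * R.transpose).trace := by
    simp [Matrix.trace, Matrix.mul_apply]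
  have hi : (A.transpose * H * A)⁻¹ = A' * H⁻¹ * A'.transpose := by
    have h2 : A'.transpose * A.transpose = 1 := by
      rw [← Matrix.transpose_mul, hA2, Matrix.transpose_one]
    rw [Matrix.mul_inv_rev, Matrix.mul_inv_rev, Matrix.inv_eq_left_inv hA,
      Matrix.inv_eq_left_inv h2, Matrix.mul_assoc]
  have h1 : A'.transpose * A.transpose = 1 := by
    rw [← Matrix.transpose_mul, hA2, Matrix.transpose_one]
  rw [key, key, hi]
  calc _ = (A' * H⁻¹ * (A'.transpose * A.transpose) * C.transpose * A).trace := by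
        simp only [Matrix.transpose_mul, Matrix.transpose_transpose, Matrix.mul_assoc]
    _ = (A * A' * H⁻¹ * C.transpose).trace := by
        rw [h1, Matrix.mul_one, Matrix.trace_mul_comm]
        simp only [Matrix.mul_assoc]
    _ = _ := by rw [hA2, Matrix.one_mul]

theorem gram_sum_smul {p : ℕ} {V : Type*} [TopologicalSpace V] [AddCommGroup V] [Module ℝ V]
    (F : V →L[ℝ] V →L[ℝ] ℝ) (b v : Fin p → V) (A : Matrix (Fin p) (Fin p) ℝ)
    (hv : ∀ α, v α = ∑ a, A a α • b a) (α β : Fin p) :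
    F (v α) (v β) = (A.transpose * Matrix.of (fun a c => F (b a) (b c)) * A) α β := by
  rw [hv, hv]
  simp only [map_sum, map_smul, sum_apply, smul_apply, smul_eq_mul, Matrix.mul_apply,
    Matrix.transpose_apply, Matrix.of_apply, Finset.sum_mul, Finset.mul_sum]
  exact Finset.sum_congr rfl fun c _ => Finset.sum_congr rfl fun a _ => by ring

/-! ### The field `X` and the least squares Lagrangian in induced jet coordinates. -/

section JetCharts

variable {p n : ℕ} {T M : Type*}
  [TopologicalSpace T] [ChartedSpace (EuclideanSpace ℝ (Fin p)) T] [IsManifold (𝓡 p) ∞ T]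
  [TopologicalSpace M] [ChartedSpace (EuclideanSpace ℝ (Fin n)) M] [IsManifold (𝓡 n) ∞ M]
  {e : OpenPartialHomeomorph T (EuclideanSpace ℝ (Fin p))}
  {f : OpenPartialHomeomorph M (EuclideanSpace ℝ (Fin n))}

/-- The component is a composite of smooth maps: a coordinate section into `TT × M`, then `X`, then
the tangent map of `f` and a coordinate projection. -/
theorem contDiffOn_fieldComp (he : e ∈ IsManifold.maximalAtlas (𝓡 p) ∞ T)
    (hf : f ∈ IsManifold.maximalAtlas (𝓡 n) ∞ M) {X : JetField p n T M} (hX : X.IsSmooth)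
    (i : Fin n) (α : Fin p) :
    ContDiffOn ℝ ∞ (fun q : EuclideanSpace ℝ (Fin p) × EuclideanSpace ℝ (Fin n) =>
      fieldComp X e f q.1 q.2 i α) (e.target ×ˢ f.target) := by
  have h1 : ContMDiffOn 𝓘(ℝ, EuclideanSpace ℝ (Fin p) × EuclideanSpace ℝ (Fin n))
      ((𝓡 p).tangent.prod (𝓡 n)) ∞
      (fun q : EuclideanSpace ℝ (Fin p) × EuclideanSpace ℝ (Fin n) =>
        ((⟨e.symm q.1, coordVec e α q.1⟩, f.symm q.2) : TangentBundle (𝓡 p) T × M))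
      (e.target ×ˢ f.target) := by
    refine ContMDiffOn.prodMk ?_ ?_
    · exact (contMDiffOn_coordVec he α).comp (contMDiffOn_iff_contDiffOn.2 contDiffOn_fst)
        (fun q hq => hq.1)
    · exact (contMDiffOn_symm_of_mem_maximalAtlas hf).comp
        (contMDiffOn_iff_contDiffOn.2 contDiffOn_snd) (fun q hq => hq.2)
  have h2 := hX.comp_contMDiffOn h1
  have h3 := (contMDiffOn_of_mem_maximalAtlas hf).contMDiffOn_tangentMapWithin
    (m := ∞) (by simp) f.open_source.uniqueMDiffOn
  have h4 := h3.comp h2 (fun q hq => f.map_target hq.2)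
  have h5 := (contMDiff_snd_tangentBundle_modelSpace (n := ∞) (EuclideanSpace ℝ (Fin n))
    (𝓡 n)).comp_contMDiffOn h4
  have h6 := (contMDiffOn_iff_contDiffOn.1 h5)
  have h7 := (EuclideanSpace.proj i : EuclideanSpace ℝ (Fin n) →L[ℝ] ℝ).contDiff.comp_contDiffOn h6
  refine h7.congr fun q hq => ?_
  simp only [Function.comp, tangentMapWithin, fieldComp, coordForm]
  rw [mfderivWithin_of_isOpen f.open_source (f.map_target hq.2)]
  rfl

/-- The Lagrangian is defined with the standard basis of the model space. Passing to the coordinate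
basis changes both Gram matrices by the same congruence, which leaves the contraction unchanged. -/
theorem leastSquares_jetPoint (he : e ∈ IsManifold.maximalAtlas (𝓡 p) ∞ T)
    (hf : f ∈ IsManifold.maximalAtlas (𝓡 n) ∞ M) (g : RiemMetric p T) (φ : RiemMetric n M)
    (X : JetField p n T M) {z : JetCoord p n} (hz : z ∈ jetDomain e f) :
    leastSquares g φ X (jetPoint e f z) =
      ∑ α, ∑ β, ∑ i, ∑ j, (metricComp g e z.1)⁻¹ α β * metricComp φ f z.2.1 i j
        * (z.2.2 i α - fieldComp X e f z.1 z.2.1 i α)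
        * (z.2.2 j β - fieldComp X e f z.1 z.2.1 j β) := by
  obtain ⟨u, y, w⟩ := z
  obtain ⟨hu, hy⟩ : u ∈ e.target ∧ y ∈ f.target := hz
  let b : Fin p → TangentSpace (𝓡 p) (e.symm u) :=
    fun α => (EuclideanSpace.single α (1 : ℝ) : EuclideanSpace ℝ (Fin p))
  let J : TangentSpace (𝓡 p) (e.symm u) →L[ℝ] TangentSpace (𝓡 n) (f.symm y) :=
    (jetPoint e f (u, y, w)).lin
  let D : TangentSpace (𝓡 p) (e.symm u) →L[ℝ] TangentSpace (𝓡 n) (f.symm y) :=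
    J - X (e.symm u) (f.symm y)
  let v : Fin p → EuclideanSpace ℝ (Fin p) := fun α => coordVec e α u
  -- `A` expresses the coordinate vectors in the standard basis; `A'`, built from the coordinate
  -- forms, is its inverse by duality.
  let A : Matrix (Fin p) (Fin p) ℝ := Matrix.of fun a α => v α a
  let A' : Matrix (Fin p) (Fin p) ℝ := Matrix.of fun α a => coordForm e α (e.symm u) (b a)
  have hb (α : Fin p) : coordVec e α u = ∑ a, A a α • b a := euclidean_sum_single (v α)
  have hA : A' * A = 1 := by
    ext α β
    rw [Matrix.one_apply, ← coordForm_coordVec he hu, hb, map_sum, Matrix.mul_apply]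
    simp [A', mul_comm]
  have hD (α : Fin p) : D (coordVec e α u)
      = ∑ i, (w i α - fieldComp X e f u y i α) • coordVec f i y := by
    simp only [D, sub_smul, Finset.sum_sub_distrib]
    rw [sub_apply]
    congr 1
    · simp [J, jetPoint, coordForm_coordVec he hu]
    · exact sum_coordForm_smul_coordVec hf hy _
  let H : Matrix (Fin p) (Fin p) ℝ := Matrix.of fun α β => g.inner (e.symm u) (b α) (b β)
  let C : Matrix (Fin p) (Fin p) ℝ :=
    Matrix.of fun α β => φ.inner (f.symm y) (D (b α)) (D (b β))
  have hH : metricComp g e u = A.transpose * H * A := by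
    ext α β
    exact gram_sum_smul (g.inner (e.symm u)) b _ A hb α β
  have hC (α β : Fin p) : (A.transpose * C * A) α β
      = φ.inner (f.symm y) (D (coordVec e α u)) (D (coordVec e β u)) :=
    (gram_sum_smul (φ.inner (f.symm y)) (fun a => D (b a)) (fun α => D (coordVec e α u)) A
      (fun α => by rw [hb, map_sum]; simp only [map_smul]) α β).symm
  have : leastSquares g φ X (jetPoint e f (u, y, w)) = ∑ α, ∑ β, H⁻¹ α β * C α β := rfl
  rw [this, ← sum_inv_mul_congruence A A' H C hA, ← hH]
  refine Finset.sum_congr rfl fun α _ => Finset.sum_congr rfl fun β _ => ?_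
  rw [hC, hD, hD]
  simp only [map_sum, map_smul, sum_apply, smul_apply, smul_eq_mul, Finset.mul_sum]
  rw [Finset.sum_comm]
  refine Finset.sum_congr rfl fun i _ => Finset.sum_congr rfl fun j _ => ?_
  simp only [metricComp, Matrix.of_apply]
  ring

end JetCharts

/-! ### Potential, Cartan connection, Ricci tensor and scalar curvature of the least squares
Lagrangian. -/

namespace IsLocalLeastSquares

variable {p n : ℕ} {U : Set (EuclideanSpace ℝ (Fin p))} {V : Set (EuclideanSpace ℝ (Fin n))}
  {h : MatField p} {φ : MatField n} {X : FieldComp p n} {L : JetCoord p n → ℝ}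

section

variable (S : IsLocalLeastSquares U V h φ X L)
include S

theorem isOpen : IsOpen (jetOver U V) := isOpen_jetOver S.isOpen_time S.isOpen_space

theorem det_h (u) (hu : u ∈ U) : (h u).det ≠ 0 := (S.posDef_h u hu).det_pos.ne'

theorem det_φ (y) (hy : y ∈ V) : (φ y).det ≠ 0 := (S.posDef_φ y hy).det_pos.ne'

theorem symm_h (u) (hu : u ∈ U) : (h u).transpose = h u := by
  simpa using (S.posDef_h u hu).isHermitian.eq

theorem symm_φ (y) (hy : y ∈ V) : (φ y).transpose = φ y := by
  simpa using (S.posDef_φ y hy).isHermitian.eq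

theorem differentiableAt_X {z : JetCoord p n} (hz : z ∈ jetOver U V) (i : Fin n) (α : Fin p) :
    DifferentiableAt ℝ (fun q : EuclideanSpace ℝ (Fin p) × EuclideanSpace ℝ (Fin n) =>
      X q.1 q.2 i α) (z.1, z.2.1) :=
  ((S.smooth_X i α).differentiableOn (by simp)).differentiableAt
    ((S.isOpen_time.prod S.isOpen_space).mem_nhds ⟨hz.1, hz.2⟩)

/-- Differential of the deviation `x^i_α - X^i_α` along a vertical vector. -/
theorem hasFDerivAt_deviation {z : JetCoord p n} (hz : z ∈ jetOver U V) (i : Fin n) (α : Fin p) :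
    ∃ D : JetCoord p n →L[ℝ] ℝ,
      HasFDerivAt (fun w : JetCoord p n => w.2.2 i α - X w.1 w.2.1 i α) D z ∧
      ∀ j β, D (vert j β) = if i = j ∧ α = β then 1 else 0 := by
  let l : JetCoord p n →L[ℝ] ℝ :=
    (ContinuousLinearMap.proj (R := ℝ) (φ := fun _ : Fin p => ℝ) α).comp
      ((ContinuousLinearMap.proj (R := ℝ) (φ := fun _ : Fin n => Fin p → ℝ) i).comp
      ((ContinuousLinearMap.snd ℝ _ _).comp (ContinuousLinearMap.snd ℝ _ _)))
  let π : JetCoord p n →L[ℝ] EuclideanSpace ℝ (Fin p) × EuclideanSpace ℝ (Fin n) :=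
    (ContinuousLinearMap.fst ℝ _ _).prod
      ((ContinuousLinearMap.fst ℝ _ _).comp (ContinuousLinearMap.snd ℝ _ _))
  have h1 := l.hasFDerivAt (x := z)
  have h2 := HasFDerivAt.comp z (f := π)
    (g := fun q : EuclideanSpace ℝ (Fin p) × EuclideanSpace ℝ (Fin n) => X q.1 q.2 i α)
    (S.differentiableAt_X hz i α).hasFDerivAt π.hasFDerivAt
  refine ⟨_, h1.sub h2, fun j β => ?_⟩
  -- A vertical vector does not move `(t, x)`, so `X` contributes nothing.
  have hπ : π (vert j β) = 0 := rfl
  have h3 : ((fderiv ℝ (fun q : EuclideanSpace ℝ (Fin p) × EuclideanSpace ℝ (Fin n) =>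
      X q.1 q.2 i α) (z.1, z.2.1)).comp π) (vert j β) = 0 := by
    rw [ContinuousLinearMap.comp_apply, hπ, map_zero]
  exact (sub_apply l _ (vert j β)).trans (by rw [h3]; simp [l, vert])

/-- Differential of a coefficient `h^{αβ} φ_{ij}`; it vanishes along vertical vectors. -/
theorem hasFDerivAt_coeff {z : JetCoord p n} (hz : z ∈ jetOver U V) (α β : Fin p) (i j : Fin n) :
    ∃ D : JetCoord p n →L[ℝ] ℝ,
      HasFDerivAt (fun w : JetCoord p n => (h w.1)⁻¹ α β * φ w.2.1 i j) D z ∧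
      ∀ k γ, D (vert k γ) = 0 := by
  have h1 := ((S.smooth_h.inv S.det_h).differentiableAt S.isOpen_time hz.1 α β).hasFDerivAt.comp z
    (hasFDerivAt_fst (𝕜 := ℝ) (p := z))
  have h2 := (S.smooth_φ.differentiableAt S.isOpen_space hz.2 i j).hasFDerivAt.comp z
    ((ContinuousLinearMap.fst ℝ (EuclideanSpace ℝ (Fin n)) (Fin n → Fin p → ℝ)).comp
      (ContinuousLinearMap.snd ℝ (EuclideanSpace ℝ (Fin p)) _)).hasFDerivAt
  exact ⟨_, h1.mul h2, fun k γ => by simp [vert]⟩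

/-- Along the fibre only the two deviation factors vary. Their contributions agree by symmetry of
`h⁻¹` and `φ`, whence the factor 2. -/
theorem fderiv_vert {z : JetCoord p n} (hz : z ∈ jetOver U V) (j : Fin n) (β : Fin p) :
    fderiv ℝ L z (vert j β) = 2 * ∑ μ, ∑ m, (h z.1)⁻¹ β μ * φ z.2.1 j m
      * (z.2.2 m μ - X z.1 z.2.1 m μ) := by
  have heq : L =ᶠ[nhds z] fun z => ∑ α, ∑ β, ∑ i, ∑ j, (h z.1)⁻¹ α β * φ z.2.1 i j
      * (z.2.2 i α - X z.1 z.2.1 i α) * (z.2.2 j β - X z.1 z.2.1 j β) :=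
    Filter.eventually_of_mem (S.isOpen.mem_nhds hz) fun w hw => S.eq_sum w hw.1 hw.2
  choose D hD hDv using fun i α => S.hasFDerivAt_deviation hz i α
  choose C hC hCv using fun α β i j => S.hasFDerivAt_coeff hz α β i j
  have hL := HasFDerivAt.fun_sum (u := Finset.univ) fun α _ =>
    HasFDerivAt.fun_sum (u := Finset.univ) fun β _ =>
      HasFDerivAt.fun_sum (u := Finset.univ) fun i _ =>
        HasFDerivAt.fun_sum (u := Finset.univ) fun j _ =>
          ((hC α β i j).fun_mul (hD i α)).fun_mul (hD j β)
  have hP (a b : Fin p) : (h z.1)⁻¹ a b = (h z.1)⁻¹ b a := by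
    conv_rhs => rw [← S.symm_h _ hz.1, ← Matrix.transpose_nonsing_inv, Matrix.transpose_apply]
  have hF (a b : Fin n) : φ z.2.1 a b = φ z.2.1 b a :=
    congrFun (congrFun (S.symm_φ _ hz.2) b) a
  rw [heq.fderiv_eq]
  rw [HasFDerivAt.fderiv hL]
  simp only [sum_apply, add_apply, smul_apply, smul_eq_mul, hDv, hCv, Finset.sum_add_distrib,
    mul_zero, add_zero, ite_and, mul_ite, mul_one]
  simp only [Finset.sum_ite_eq', Finset.sum_ite_irrel, Finset.sum_const_zero, Finset.mem_univ,
    if_true]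
  rw [two_mul]
  congr 1
  · refine Finset.sum_congr rfl fun a _ => Finset.sum_congr rfl fun b _ => ?_
    rw [hP, hF]
  · refine Finset.sum_congr rfl fun a _ => Finset.sum_congr rfl fun b _ => ?_
    ring

theorem verticalMetric_eq {z : JetCoord p n} (hz : z ∈ jetOver U V) (i : Fin n) (α : Fin p)
    (j : Fin n) (β : Fin p) : verticalMetric L i α j β z = (h z.1)⁻¹ α β * φ z.2.1 i j := by
  have heq : (fun w => fderiv ℝ L w (vert j β)) =ᶠ[nhds z] fun z =>
      2 * ∑ μ, ∑ m, (h z.1)⁻¹ β μ * φ z.2.1 j m * (z.2.2 m μ - X z.1 z.2.1 m μ) :=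
    Filter.eventually_of_mem (S.isOpen.mem_nhds hz) fun w hw => S.fderiv_vert hw j β
  choose D hD hDv using fun i α => S.hasFDerivAt_deviation hz i α
  choose C hC hCv using fun α β i j => S.hasFDerivAt_coeff hz α β i j
  have hL := (HasFDerivAt.fun_sum (u := Finset.univ) fun μ _ =>
    HasFDerivAt.fun_sum (u := Finset.univ) fun m _ =>
      (hC β μ j m).fun_mul (hD m μ)).const_mul 2
  have hP (a b : Fin p) : (h z.1)⁻¹ a b = (h z.1)⁻¹ b a := by
    conv_rhs => rw [← S.symm_h _ hz.1, ← Matrix.transpose_nonsing_inv, Matrix.transpose_apply]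
  have hF (a b : Fin n) : φ z.2.1 a b = φ z.2.1 b a :=
    congrFun (congrFun (S.symm_φ _ hz.2) b) a
  rw [verticalMetric, heq.fderiv_eq, HasFDerivAt.fderiv hL]
  simp only [sum_apply, add_apply, smul_apply, smul_eq_mul, hDv, hCv, Finset.sum_add_distrib,
    mul_zero, ite_and, mul_ite, mul_one]
  simp only [Finset.sum_ite_eq', Finset.sum_const_zero, Finset.mem_univ, if_true, add_zero]
  rw [hP, hF]
  ring

/-- The contraction `h_{αβ} h^{αβ} = p` cancels the normalising factor; this is where `p` must be
nonzero. -/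
theorem spatialMetric_eq (hp : 0 < p) {z : JetCoord p n} (hz : z ∈ jetOver U V) :
    spatialMetric h L z = φ z.2.1 := by
  have h1 : h z.1 * (h z.1)⁻¹ = 1 :=
    Matrix.mul_nonsing_inv _ (isUnit_iff_ne_zero.2 (S.det_h _ hz.1))
  have hP (a b : Fin p) : (h z.1)⁻¹ a b = (h z.1)⁻¹ b a := by
    conv_rhs => rw [← S.symm_h _ hz.1, ← Matrix.transpose_nonsing_inv, Matrix.transpose_apply]
  have h2 : ∑ α, ∑ β, h z.1 α β * (h z.1)⁻¹ α β = p := by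
    have : (h z.1 * (h z.1)⁻¹).trace = p := by simp [h1]
    rw [← this]
    simp only [Matrix.trace, Matrix.diag, Matrix.mul_apply]
    exact Finset.sum_congr rfl fun a _ => Finset.sum_congr rfl fun b _ => by rw [hP]
  ext i j
  simp only [spatialMetric, Matrix.of_apply, S.verticalMetric_eq hz, ← mul_assoc,
    ← Finset.sum_mul, h2]
  have : (p : ℝ) ≠ 0 := by exact_mod_cast hp.ne'
  field_simp

theorem smooth_christoffel_h (α β γ : Fin p) : ContDiffOn ℝ ∞ (christoffel h α β γ) U :=
  smoothMatOn_connMat S.isOpen_time S.smooth_h S.det_h γ α β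

theorem smooth_christoffel_φ (i j k : Fin n) : ContDiffOn ℝ ∞ (christoffel φ i j k) V :=
  smoothMatOn_connMat S.isOpen_space S.smooth_φ S.det_φ k i j

theorem frameDeriv_spatialMetric (hp : 0 < p) (Γ : NonlinearConnection p n) {z : JetCoord p n}
    (hz : z ∈ jetOver U V) (i j : Fin n) (A : AIdx p n) :
    frameDeriv Γ A (fun w => spatialMetric h L w i j) z
      = Sum.elim (fun _ => 0)
        (Sum.elim (fun k => pd k (fun y => φ y i j) z.2.1) (fun _ => 0)) A := by
  rw [frameDeriv_congr Γ S.isOpen (G := fun w => φ w.2.1 i j)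
    (fun w hw => by simp only [S.spatialMetric_eq hp hw]) hz]
  exact frameDeriv_comp_space Γ (S.smooth_φ.differentiableAt S.isOpen_space hz.2 i j) A

/-- Because `g_{ij} = φ_{ij}(x)`, the only surviving derivatives of `g` are the `δ/δx^k`, and these
reduce to `∂/∂x^k`. No property of `Γ` plays a part. -/
theorem cartan_eq_baseConn (hp : 0 < p) (Γ : NonlinearConnection p n) (D A B : AIdx p n) :
    Set.EqOn (cartan h L Γ D A B) (baseConn h φ D A B) (jetOver U V) := by
  intro z hz
  have hG (k j γ) : cartanG h L Γ k j γ z = 0 := by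
    simp [cartanG, S.frameDeriv_spatialMetric hp Γ hz]
  have hC (k i j γ) : cartanC h L Γ k i j γ z = 0 := by
    simp [cartanC, S.frameDeriv_spatialMetric hp Γ hz]
  have hL (k i j) : cartanL h L Γ k i j z = christoffel φ k i j z.2.1 := by
    simp [cartanL, S.frameDeriv_spatialMetric hp Γ hz, S.spatialMetric_eq hp hz, christoffel]
  rcases D with α | i | ⟨i, α⟩ <;> rcases A with β | j | ⟨j, β⟩ <;>
    rcases B with γ | k | ⟨k, γ⟩ <;> simp only [cartan, baseConn, hG, hC, hL]
  all_goals split_ifs <;> simp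

theorem ricciD_cartan (hp : 0 < p) (Γ : NonlinearConnection p n) {z : JetCoord p n}
    (hz : z ∈ jetOver U V) (A B : AIdx p n) :
    ricciD Γ (cartan h L Γ) A B z = baseRicci h φ z A B :=
  ricciD_eq_baseRicci Γ S.isOpen (S.cartan_eq_baseConn hp Γ) hz
    (fun α β γ => differentiableAt_of_contDiffOn S.isOpen_time (S.smooth_christoffel_h α β γ) hz.1)
    (fun i j k => differentiableAt_of_contDiffOn S.isOpen_space (S.smooth_christoffel_φ i j k) hz.2)
    A B

theorem hPotential_eq (hp : 0 < p) (Γ : NonlinearConnection p n) {z : JetCoord p n}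
    (hz : z ∈ jetOver U V) (v w : JetCoord p n) :
    hPotential h L Γ z v w = (∑ α, ∑ β, h z.1 α β * v.1 α * w.1 β)
      + (∑ i, ∑ j, φ z.2.1 i j * v.2.1 i * w.2.1 j)
      + ∑ i, ∑ j, ∑ α, ∑ β, (h z.1)⁻¹ α β * φ z.2.1 i j
          * deltaX Γ i α z v * deltaX Γ j β z w := by
  simp only [hPotential, S.spatialMetric_eq hp hz]

theorem hPotential_symm (hp : 0 < p) (Γ : NonlinearConnection p n) {z : JetCoord p n}
    (hz : z ∈ jetOver U V) (v w : JetCoord p n) :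
    hPotential h L Γ z v w = hPotential h L Γ z w v := by
  have hH (a b : Fin p) : h z.1 a b = h z.1 b a := congrFun (congrFun (S.symm_h _ hz.1) b) a
  have hP (a b : Fin p) : (h z.1)⁻¹ a b = (h z.1)⁻¹ b a := by
    conv_rhs => rw [← S.symm_h _ hz.1, ← Matrix.transpose_nonsing_inv, Matrix.transpose_apply]
  have hF (a b : Fin n) : φ z.2.1 a b = φ z.2.1 b a :=
    congrFun (congrFun (S.symm_φ _ hz.2) b) a
  rw [S.hPotential_eq hp Γ hz, S.hPotential_eq hp Γ hz]
  congr 1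
  · congr 1
    · rw [Finset.sum_comm]
      exact Finset.sum_congr rfl fun a _ => Finset.sum_congr rfl fun b _ => by rw [hH]; ring
    · rw [Finset.sum_comm]
      exact Finset.sum_congr rfl fun a _ => Finset.sum_congr rfl fun b _ => by rw [hF]; ring
  · rw [Finset.sum_comm]
    refine Finset.sum_congr rfl fun i _ => Finset.sum_congr rfl fun j _ => ?_
    rw [Finset.sum_comm]
    exact Finset.sum_congr rfl fun a _ => Finset.sum_congr rfl fun b _ => by rw [hP, hF]; ring

/-- The form is a sum of three positive definite ones, the vertical one being the Kronecker product
of `φ` and `h⁻¹`. When the `dt` and `dx` parts of `v` vanish, `δx^i_α` is the plain fibre coordinate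
of `v`, so some block is nonzero. -/
theorem hPotential_pos (hp : 0 < p) (Γ : NonlinearConnection p n) {z : JetCoord p n}
    (hz : z ∈ jetOver U V) {v : JetCoord p n} (hv : v ≠ 0) : 0 < hPotential h L Γ z v v := by
  have quad {ι : Type} [Fintype ι] (A : Matrix ι ι ℝ) (x : ι → ℝ) :
      ∑ a, ∑ b, A a b * x a * x b = star x ⬝ᵥ A.mulVec x := by
    simp [dotProduct, Matrix.mulVec, Finset.mul_sum, mul_comm, mul_left_comm]
  have hK : (Matrix.kronecker (φ z.2.1) (h z.1)⁻¹).PosDef :=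
    (S.posDef_φ _ hz.2).kronecker (S.posDef_h _ hz.1).inv
  let a : Fin n × Fin p → ℝ := fun q => deltaX Γ q.1 q.2 z v
  have e3 : ∑ i, ∑ j, ∑ α, ∑ β, (h z.1)⁻¹ α β * φ z.2.1 i j
      * deltaX Γ i α z v * deltaX Γ j β z v
      = star a ⬝ᵥ (Matrix.kronecker (φ z.2.1) (h z.1)⁻¹).mulVec a := by
    rw [← quad]
    simp only [Fintype.sum_prod_type]
    refine Finset.sum_congr rfl fun i _ => ?_
    rw [Finset.sum_comm]
    refine Finset.sum_congr rfl fun α _ => Finset.sum_congr rfl fun j _ =>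
      Finset.sum_congr rfl fun β _ => ?_
    simp [a, Matrix.kronecker, mul_comm]
  rw [S.hPotential_eq hp Γ hz, e3, quad (h z.1) (fun α => v.1 α),
    quad (φ z.2.1) (fun i => v.2.1 i)]
  have p1 := (S.posDef_h _ hz.1).posSemidef.dotProduct_mulVec_nonneg (fun α => v.1 α)
  have p2 := (S.posDef_φ _ hz.2).posSemidef.dotProduct_mulVec_nonneg (fun i => v.2.1 i)
  have p3 := hK.posSemidef.dotProduct_mulVec_nonneg a
  by_cases h1 : v.1 = 0
  · by_cases h2 : v.2.1 = 0
    · have h3 : a ≠ 0 := by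
        intro ha
        apply hv
        refine Prod.ext h1 (Prod.ext h2 ?_)
        funext i α
        simpa [a, deltaX, h1, h2] using congrFun ha (i, α)
      have := hK.dotProduct_mulVec_pos h3
      linarith
    · have h3 : (fun i => v.2.1 i) ≠ 0 := fun h0 => h2 (by ext i; exact congrFun h0 i)
      have := (S.posDef_φ _ hz.2).dotProduct_mulVec_pos h3
      linarith
  · have h3 : (fun α => v.1 α) ≠ 0 := fun h0 => h1 (by ext i; exact congrFun h0 i)
    have := (S.posDef_h _ hz.1).dotProduct_mulVec_pos h3
    linarith

theorem adaptedComp_hPotential (hp : 0 < p) (Γ : NonlinearConnection p n) {z : JetCoord p n}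
    (hz : z ∈ jetOver U V) :
    adaptedComp Γ (hPotential h L Γ) z = Matrix.fromBlocks (h z.1) 0 0
      (Matrix.fromBlocks (φ z.2.1) 0 0 (Matrix.kronecker (φ z.2.1) (h z.1)⁻¹)) := by
  have hd (i : Fin n) (α : Fin p) (A : AIdx p n) :
      deltaX Γ i α z (frame Γ A z) = if (.inr (.inr (i, α)) : AIdx p n) = A then 1 else 0 :=
    coframe_frame Γ (.inr (.inr (i, α))) A z
  ext A B
  rw [adaptedComp, Matrix.of_apply, S.hPotential_eq hp Γ hz]
  simp only [hd]
  rcases A with α | i | ⟨i, α⟩ <;> rcases B with β | j | ⟨j, β⟩ <;>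
    simp [frame, vert, Matrix.kronecker, ite_and, Finset.sum_ite_irrel, mul_comm]

/-- The inverse of the block diagonal potential is block diagonal, and the vertical Ricci block is
zero, so only the two base curvatures are traced. -/
theorem scalarD_cartan (hp : 0 < p) (Γ : NonlinearConnection p n) {z : JetCoord p n}
    (hz : z ∈ jetOver U V) :
    scalarD Γ (cartan h L Γ) (hPotential h L Γ) z = scalarCurv h z.1 + scalarCurv φ z.2.1 := by
  have hinv : (adaptedComp Γ (hPotential h L Γ) z)⁻¹ = Matrix.fromBlocks (h z.1)⁻¹ 0 0
      (Matrix.fromBlocks (φ z.2.1)⁻¹ 0 0 (Matrix.kronecker (φ z.2.1)⁻¹ (h z.1))) := by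
    have h1 : h z.1 * (h z.1)⁻¹ = 1 :=
      Matrix.mul_nonsing_inv _ (isUnit_iff_ne_zero.2 (S.det_h _ hz.1))
    have h2 : (h z.1)⁻¹ * h z.1 = 1 :=
      Matrix.nonsing_inv_mul _ (isUnit_iff_ne_zero.2 (S.det_h _ hz.1))
    have h3 : φ z.2.1 * (φ z.2.1)⁻¹ = 1 :=
      Matrix.mul_nonsing_inv _ (isUnit_iff_ne_zero.2 (S.det_φ _ hz.2))
    apply Matrix.inv_eq_right_inv
    rw [S.adaptedComp_hPotential hp Γ hz]
    simp [Matrix.fromBlocks_multiply, h1, h3, Matrix.kronecker, ← Matrix.mul_kronecker_mul, h2]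
  simp only [scalarD, hinv, S.ricciD_cartan hp Γ hz, Fintype.sum_sum_type, baseRicci]
  simp [scalarCurv]

end

end IsLocalLeastSquares

/-! ### Divergence of the Einstein tensor of one metric. -/

section EinsteinDivergence

variable {m : ℕ} {U : Set (EuclideanSpace ℝ (Fin m))} {g : MatField m}
  {u : EuclideanSpace ℝ (Fin m)}

theorem differentiableAt_scalarCurv (hU : IsOpen U) (hg : SmoothMatOn g U)
    (h0 : ∀ u ∈ U, (g u).det ≠ 0) (hs : ∀ u ∈ U, (g u).transpose = g u) (hu : u ∈ U) :
    DifferentiableAt ℝ (scalarCurv g) u :=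
  differentiableAt_of_contDiffOn hU ((ContDiffOn.sum fun a _ =>
    contDiffOn_ricciMixed hU hg h0 a a).congr fun w hw => scalarCurv_eq_sum_ricciMixed (hs w hw)) hu

/-- Raising the first index in `r_{ab} - (c / 2) g_{ab} = K t_{ab}`. -/
theorem sum_inv_mul_of_einstein (h0 : (g u).det ≠ 0) {K : ℝ} (hK : K ≠ 0) {c : ℝ}
    {t : Fin m → Fin m → ℝ} (ht : ∀ a b, ricci g a b u - c / 2 * g u a b = K * t a b)
    (a b : Fin m) : ∑ s, (g u)⁻¹ a s * t s b
      = K⁻¹ * (ricciMixed g a b u - (if a = b then 1 / 2 else 0) * c) := by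
  have h1 : (g u)⁻¹ * g u = 1 := Matrix.nonsing_inv_mul _ (isUnit_iff_ne_zero.2 h0)
  have h2 : ∑ s, (g u)⁻¹ a s * g u s b = if a = b then 1 else 0 := by
    rw [← Matrix.mul_apply, h1, Matrix.one_apply]
  have h3 (s : Fin m) : t s b = K⁻¹ * (ricci g s b u - c / 2 * g u s b) := by
    rw [ht, inv_mul_cancel_left₀ hK]
  have h4 : (∑ s, (g u)⁻¹ a s * t s b) = K⁻¹ * (ricciMixed g a b u
      - (∑ s, (g u)⁻¹ a s * g u s b) * (c / 2)) := by
    simp only [ricciMixed, h3, Finset.sum_mul, ← Finset.sum_sub_distrib, Finset.mul_sum]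
    exact Finset.sum_congr rfl fun s _ => by ring
  rw [h4, h2]
  split_ifs <;> ring

/-- The mixed tensor `K⁻¹ (r^a_b - (c / 2) δ^a_b)` is divergence free when `dc` is the differential
of the scalar curvature. -/
theorem sum_divergence_eq_zero (hU : IsOpen U) (hg : SmoothMatOn g U)
    (h0 : ∀ u ∈ U, (g u).det ≠ 0) (hs : ∀ u ∈ U, (g u).transpose = g u) (hu : u ∈ U) (K c : ℝ)
    (j : Fin m) :
    ∑ i, (K⁻¹ * (pd i (ricciMixed g i j) u - (if i = j then 1 / 2 else 0) * pd i (scalarCurv g) u)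
      + ∑ s, (christoffel g i s i u
          * (K⁻¹ * (ricciMixed g s j u - (if s = j then 1 / 2 else 0) * c))
        - christoffel g s j i u
          * (K⁻¹ * (ricciMixed g i s u - (if i = s then 1 / 2 else 0) * c)))) = 0 := by
  have hterm (i : Fin m) : K⁻¹ * (pd i (ricciMixed g i j) u
        - (if i = j then 1 / 2 else 0) * pd i (scalarCurv g) u)
      + ∑ s, (christoffel g i s i u
          * (K⁻¹ * (ricciMixed g s j u - (if s = j then 1 / 2 else 0) * c))
        - christoffel g s j i u
          * (K⁻¹ * (ricciMixed g i s u - (if i = s then 1 / 2 else 0) * c)))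
      = K⁻¹ * ((pd i (ricciMixed g i j) u + ∑ s, (christoffel g i s i u * ricciMixed g s j u
          - christoffel g s j i u * ricciMixed g i s u))
        - (if i = j then 1 / 2 else 0) * pd i (scalarCurv g) u) := by
    -- The Kronecker delta is parallel: its two Christoffel corrections cancel, so `c` enters only
    -- through its derivative.
    have h6 : ∑ s, (christoffel g i s i u * (if s = j then 1 / 2 else 0)
        - christoffel g s j i u * (if i = s then 1 / 2 else 0)) = 0 := by
      simp [Finset.sum_sub_distrib]
    have h7 : ∑ s, (christoffel g i s i u
          * (K⁻¹ * (ricciMixed g s j u - (if s = j then 1 / 2 else 0) * c))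
        - christoffel g s j i u
          * (K⁻¹ * (ricciMixed g i s u - (if i = s then 1 / 2 else 0) * c)))
        = K⁻¹ * (∑ s, (christoffel g i s i u * ricciMixed g s j u
            - christoffel g s j i u * ricciMixed g i s u))
          - K⁻¹ * c * ∑ s, (christoffel g i s i u * (if s = j then 1 / 2 else 0)
              - christoffel g s j i u * (if i = s then 1 / 2 else 0)) := by
      simp only [Finset.mul_sum, ← Finset.sum_sub_distrib]
      exact Finset.sum_congr rfl fun s _ => by ring
    rw [h7, h6]
    ring
  rw [Finset.sum_congr rfl fun i _ => hterm i, ← Finset.mul_sum, Finset.sum_sub_distrib,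
    contracted_bianchi hU hg h0 hs hu]
  simp

end EinsteinDivergence

section FrameLinearity

variable {p n : ℕ} (Γ : NonlinearConnection p n)

theorem frameDeriv_einstein {F G H : JetCoord p n → ℝ} {z : JetCoord p n}
    (hF : DifferentiableAt ℝ F z) (hG : DifferentiableAt ℝ G z) (hH : DifferentiableAt ℝ H z)
    (A : AIdx p n) (k c : ℝ) :
    frameDeriv Γ A (fun w => k * (F w - c * (G w + H w))) z
      = k * (frameDeriv Γ A F z - c * (frameDeriv Γ A G z + frameDeriv Γ A H z)) := by
  unfold frameDeriv
  rw [fderiv_const_mul (hF.fun_sub ((hG.fun_add hH).const_mul _)),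
    fderiv_fun_sub hF ((hG.fun_add hH).const_mul _), fderiv_const_mul (hG.fun_add hH),
    fderiv_fun_add hG hH]
  simp [mul_add]

end FrameLinearity

/-! ### Conservation laws and the block form of the Einstein equations. -/

namespace IsLocalLeastSquares

variable {p n : ℕ} {U : Set (EuclideanSpace ℝ (Fin p))} {V : Set (EuclideanSpace ℝ (Fin n))}
  {h : MatField p} {φ : MatField n} {X : FieldComp p n} {L : JetCoord p n → ℝ}

/-- The divergence law for the temporal part of the Einstein tensor. -/
theorem sum_berwaldT_eq_zero (S : IsLocalLeastSquares U V h φ X L) {K : ℝ} (hK : K ≠ 0)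
    {τ : Fin p → Fin p → JetCoord p n → ℝ}
    (hτ : ∀ z ∈ jetOver U V, ∀ α β, ricci h α β z.1
      - (scalarCurv h z.1 + scalarCurv φ z.2.1) / 2 * h z.1 α β = K * τ α β z)
    {z : JetCoord p n} (hz : z ∈ jetOver U V) (β : Fin p) :
    ∑ μ, berwaldT h φ (fun μ β w => ∑ α, (h w.1)⁻¹ μ α * τ α β w) μ β μ z = 0 := by
  -- The equations hold on the whole open domain, so the raised tensor may be replaced by a smooth
  -- geometric expression before differentiating; no smoothness of `τ` is assumed.
  have hE (w) (hw : w ∈ jetOver U V) (μ β : Fin p) := sum_inv_mul_of_einstein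
    (S.det_h _ hw.1) hK (hτ w hw) μ β
  have hmix (a b : Fin p) : DifferentiableAt ℝ (ricciMixed h a b) z.1 :=
    differentiableAt_of_contDiffOn S.isOpen_time
      (contDiffOn_ricciMixed S.isOpen_time S.smooth_h S.det_h a b) hz.1
  have hsh : DifferentiableAt ℝ (scalarCurv h) z.1 :=
    differentiableAt_scalarCurv S.isOpen_time S.smooth_h S.det_h S.symm_h hz.1
  have hsφ : DifferentiableAt ℝ (scalarCurv φ) z.2.1 :=
    differentiableAt_scalarCurv S.isOpen_space S.smooth_φ S.det_φ S.symm_φ hz.2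
  -- A `t`-derivative along the adapted frame kills the scalar curvature of `φ`, which depends on
  -- `x` alone, and sees only that of `h`.
  have hd (μ β γ : Fin p) : frameDeriv (metricConnection h φ) (.inl γ)
      (fun w => ∑ α, (h w.1)⁻¹ μ α * τ α β w) z
      = K⁻¹ * (pd γ (ricciMixed h μ β) z.1
        - (if μ = β then 1 / 2 else 0) * pd γ (scalarCurv h) z.1) := by
    rw [frameDeriv_congr _ S.isOpen (fun w hw => hE w hw μ β) hz,
      frameDeriv_einstein (F := fun w => ricciMixed h μ β w.1) (G := fun w => scalarCurv h w.1)
        (H := fun w => scalarCurv φ w.2.1) _ ((hmix μ β).comp z differentiableAt_fst)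
        (hsh.comp z differentiableAt_fst) (DifferentiableAt.comp (g := scalarCurv φ) z hsφ
        (differentiableAt_fst.comp z differentiableAt_snd)),
      frameDeriv_comp_time _ (hmix μ β), frameDeriv_comp_time _ hsh, frameDeriv_comp_space _ hsφ]
    simp
  simp only [berwaldT, hd, hE z hz]
  exact sum_divergence_eq_zero S.isOpen_time S.smooth_h S.det_h S.symm_h hz.1 K _ β

/-- The divergence law for the spatial part of the Einstein tensor. -/
theorem sum_berwaldM_eq_zero (S : IsLocalLeastSquares U V h φ X L) {K : ℝ} (hK : K ≠ 0)
    {τ : Fin n → Fin n → JetCoord p n → ℝ}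
    (hτ : ∀ z ∈ jetOver U V, ∀ i j, ricci φ i j z.2.1
      - (scalarCurv h z.1 + scalarCurv φ z.2.1) / 2 * φ z.2.1 i j = K * τ i j z)
    {z : JetCoord p n} (hz : z ∈ jetOver U V) (j : Fin n) :
    ∑ m, berwaldM h φ (fun m j w => ∑ i, (φ w.2.1)⁻¹ m i * τ i j w) m j m z = 0 := by
  have hE (w) (hw : w ∈ jetOver U V) (a b : Fin n) := sum_inv_mul_of_einstein
    (S.det_φ _ hw.2) hK (hτ w hw) a b
  have hmix (a b : Fin n) : DifferentiableAt ℝ (ricciMixed φ a b) z.2.1 :=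
    differentiableAt_of_contDiffOn S.isOpen_space
      (contDiffOn_ricciMixed S.isOpen_space S.smooth_φ S.det_φ a b) hz.2
  have hsh : DifferentiableAt ℝ (scalarCurv h) z.1 :=
    differentiableAt_scalarCurv S.isOpen_time S.smooth_h S.det_h S.symm_h hz.1
  have hsφ : DifferentiableAt ℝ (scalarCurv φ) z.2.1 :=
    differentiableAt_scalarCurv S.isOpen_space S.smooth_φ S.det_φ S.symm_φ hz.2
  have hπ : DifferentiableAt ℝ (fun w : JetCoord p n => w.2.1) z :=
    differentiableAt_fst.comp z differentiableAt_snd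
  -- Here the scalar curvature of `h`, a function of `t`, is the term that is killed.
  have hd (a b c : Fin n) : frameDeriv (metricConnection h φ) (.inr (.inl c))
      (fun w => ∑ i, (φ w.2.1)⁻¹ a i * τ i b w) z
      = K⁻¹ * (pd c (ricciMixed φ a b) z.2.1
        - (if a = b then 1 / 2 else 0) * pd c (scalarCurv φ) z.2.1) := by
    rw [frameDeriv_congr _ S.isOpen (fun w hw => hE w hw a b) hz,
      frameDeriv_einstein (F := fun w => ricciMixed φ a b w.2.1) (G := fun w => scalarCurv h w.1)
        (H := fun w => scalarCurv φ w.2.1) _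
        (DifferentiableAt.comp (g := ricciMixed φ a b) z (hmix a b) hπ)
        (hsh.comp z differentiableAt_fst) (DifferentiableAt.comp (g := scalarCurv φ) z hsφ hπ),
      frameDeriv_comp_space _ (hmix a b), frameDeriv_comp_time _ hsh, frameDeriv_comp_space _ hsφ]
    simp
  simp only [berwaldM, hd, hE z hz]
  exact sum_divergence_eq_zero S.isOpen_space S.smooth_φ S.det_φ S.symm_φ hz.2 K _ j

/-- The generalized Einstein equations, block by block. -/
theorem einstein_iff (S : IsLocalLeastSquares U V h φ X L) (hp : 0 < p)
    (Γ : NonlinearConnection p n) {z : JetCoord p n} (hz : z ∈ jetOver U V) {K : ℝ} (hK : K ≠ 0)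
    (t : AIdx p n → AIdx p n → ℝ) :
    (∀ A B, ricciD Γ (cartan h L Γ) A B z
      - scalarD Γ (cartan h L Γ) (hPotential h L Γ) z / 2
        * adaptedComp Γ (hPotential h L Γ) z A B = K * t A B) ↔
    ((∀ α β, ricci h α β z.1 - (scalarCurv h z.1 + scalarCurv φ z.2.1) / 2 * h z.1 α β
          = K * t (.inl α) (.inl β)) ∧
      (∀ i j, ricci φ i j z.2.1 - (scalarCurv h z.1 + scalarCurv φ z.2.1) / 2 * φ z.2.1 i j
          = K * t (.inr (.inl i)) (.inr (.inl j))) ∧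
      (∀ i α j β, -((scalarCurv h z.1 + scalarCurv φ z.2.1) / 2) * (h z.1)⁻¹ α β * φ z.2.1 i j
          = K * t (.inr (.inr (i, α))) (.inr (.inr (j, β))))) ∧
    ((∀ α i, 0 = t (.inl α) (.inr (.inl i))) ∧
      (∀ i α, 0 = t (.inr (.inl i)) (.inl α)) ∧
      (∀ i α β, 0 = t (.inr (.inr (i, α))) (.inl β)) ∧
      (∀ α i β, 0 = t (.inl α) (.inr (.inr (i, β)))) ∧
      (∀ i j α, 0 = t (.inr (.inl i)) (.inr (.inr (j, α)))) ∧
      (∀ i α j, 0 = t (.inr (.inr (i, α))) (.inr (.inl j)))) := by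
  -- In the off-diagonal blocks both the Ricci tensor and the potential vanish; since `K ≠ 0`, the
  -- equation there says that the stress-energy component is zero.
  have hz0 (x : ℝ) : (0 - (scalarCurv h z.1 + scalarCurv φ z.2.1) / 2 * 0 = K * x) ↔ 0 = x := by
    rw [mul_zero, sub_zero, eq_comm, mul_eq_zero, or_iff_right hK, eq_comm]
  have hv (i : Fin n) (α : Fin p) (j : Fin n) (β : Fin p) :
      0 - (scalarCurv h z.1 + scalarCurv φ z.2.1) / 2 * (φ z.2.1 i j * (h z.1)⁻¹ α β)
        = -((scalarCurv h z.1 + scalarCurv φ z.2.1) / 2) * (h z.1)⁻¹ α β * φ z.2.1 i j := by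
    ring
  simp only [S.ricciD_cartan hp Γ hz, S.scalarD_cartan hp Γ hz, S.adaptedComp_hPotential hp Γ hz,
    Sum.forall, Prod.forall, baseRicci, Matrix.fromBlocks_apply₁₁, Matrix.fromBlocks_apply₁₂,
    Matrix.fromBlocks_apply₂₁, Matrix.fromBlocks_apply₂₂, Matrix.zero_apply, hz0,
    Matrix.kronecker, Matrix.kroneckerMap_apply, hv, forall_and]
  tauto

end IsLocalLeastSquares

end JetGravity

theorem mainTheorem7 {p n : ℕ} (hp : 0 < p) {T M : Type*}
    [TopologicalSpace T] [ChartedSpace (EuclideanSpace ℝ (Fin p)) T] [IsManifold (𝓡 p) ∞ T]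
    [TopologicalSpace M] [ChartedSpace (EuclideanSpace ℝ (Fin n)) M] [IsManifold (𝓡 n) ∞ M]
    (hT : JetGravity.RiemMetric p T) (φM : JetGravity.RiemMetric n M)
    (XTM : JetGravity.JetField p n T M) (hX : XTM.IsSmooth)
    (e : OpenPartialHomeomorph T (EuclideanSpace ℝ (Fin p)))
    (he : e ∈ IsManifold.maximalAtlas (𝓡 p) ∞ T)
    (f : OpenPartialHomeomorph M (EuclideanSpace ℝ (Fin n)))
    (hf : f ∈ IsManifold.maximalAtlas (𝓡 n) ∞ M) :
    -- local components of `h`, `φ`, `X`, `L`, and the canonical nonlinear connection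
    let h := JetGravity.metricComp hT e
    let φ := JetGravity.metricComp φM f
    let X := JetGravity.fieldComp XTM e f
    let L : JetGravity.JetCoord p n → ℝ :=
      fun z => JetGravity.leastSquares hT φM XTM (JetGravity.jetPoint e f z)
    let Γ := JetGravity.canonicalConnection h φ X
    -- gravitational potential and Cartan canonical connection of `(J¹(T, M), L)`
    let G := JetGravity.hPotential h L Γ
    let conn := JetGravity.cartan h L Γ
    -- (i)
    (∀ z ∈ JetGravity.jetDomain e f,
      (∀ i α j β, JetGravity.verticalMetric L i α j β z = (h z.1)⁻¹ α β * φ z.2.1 i j) ∧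
      (∀ v w, G z v w =
        (∑ α, ∑ β, h z.1 α β * v.1 α * w.1 β)
          + (∑ i, ∑ j, φ z.2.1 i j * v.2.1 i * w.2.1 j)
          + ∑ i, ∑ j, ∑ α, ∑ β, (h z.1)⁻¹ α β * φ z.2.1 i j
              * JetGravity.deltaX Γ i α z v * JetGravity.deltaX Γ j β z w) ∧
      (∀ v w, G z v w = G z w v) ∧ (∀ v, v ≠ 0 → 0 < G z v v)) ∧
    -- (ii), (iii): `K` is the Einstein constant, `𝒯` a stress-energy tensor field,
    -- `τ A B = 𝒯(X_A, X_B)` its adapted components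
    ∀ (K : ℝ), K ≠ 0 →
    ∀ (𝒯 : JetGravity.JetCoord p n →
        (JetGravity.JetCoord p n →ₗ[ℝ] JetGravity.JetCoord p n →ₗ[ℝ] ℝ)),
    let τ : JetGravity.AIdx p n → JetGravity.AIdx p n → JetGravity.JetCoord p n → ℝ :=
      fun A B z => 𝒯 z (JetGravity.frame Γ A z) (JetGravity.frame Γ B z)
    let Einstein : JetGravity.JetCoord p n → Prop := fun z => ∀ A B,
      JetGravity.ricciD Γ conn A B z
        - JetGravity.scalarD Γ conn G z / 2 * JetGravity.adaptedComp Γ G z A B = K * τ A B z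
    let Sc : JetGravity.JetCoord p n → ℝ :=
      fun z => JetGravity.scalarCurv h z.1 + JetGravity.scalarCurv φ z.2.1
    -- (ii)
    (∀ z ∈ JetGravity.jetDomain e f,
      (Einstein z ↔
        -- (E₁)
        ((∀ α β, JetGravity.ricci h α β z.1 - Sc z / 2 * h z.1 α β
            = K * τ (.inl α) (.inl β) z) ∧
          (∀ i j, JetGravity.ricci φ i j z.2.1 - Sc z / 2 * φ z.2.1 i j
            = K * τ (.inr (.inl i)) (.inr (.inl j)) z) ∧
          (∀ i α j β, -(Sc z / 2) * (h z.1)⁻¹ α β * φ z.2.1 i j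
            = K * τ (.inr (.inr (i, α))) (.inr (.inr (j, β))) z)) ∧
        -- (E₂)
        ((∀ α i, 0 = τ (.inl α) (.inr (.inl i)) z) ∧
          (∀ i α, 0 = τ (.inr (.inl i)) (.inl α) z) ∧
          (∀ i α β, 0 = τ (.inr (.inr (i, α))) (.inl β) z) ∧
          (∀ α i β, 0 = τ (.inl α) (.inr (.inr (i, β))) z) ∧
          (∀ i j α, 0 = τ (.inr (.inl i)) (.inr (.inr (j, α))) z) ∧
          (∀ i α j, 0 = τ (.inr (.inr (i, α))) (.inr (.inl j)) z)))) ∧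
    -- (iii), with `𝒯^μ_β = h^{μα} 𝒯_{αβ}` and `𝒯^m_j = φ^{mi} 𝒯_{ij}`
    ((∀ z ∈ JetGravity.jetDomain e f, Einstein z) →
      ∀ z ∈ JetGravity.jetDomain e f,
        (∀ β, ∑ μ, JetGravity.berwaldT h φ
          (fun μ β w => ∑ α, (h w.1)⁻¹ μ α * τ (.inl α) (.inl β) w) μ β μ z = 0) ∧
        (∀ j, ∑ m, JetGravity.berwaldM h φ
          (fun m j w => ∑ i, (φ w.2.1)⁻¹ m i * τ (.inr (.inl i)) (.inr (.inl j)) w) m j m z = 0))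

    := by
  intro h φ X L Γ G conn
  -- All remaining assertions concern this local data; the charts and manifolds are not used beyond
  -- it.
  have S : JetGravity.IsLocalLeastSquares e.target f.target h φ X L :=
    { isOpen_time := e.open_target
      isOpen_space := f.open_target
      smooth_h := JetGravity.contDiffOn_metricComp he hT
      smooth_φ := JetGravity.contDiffOn_metricComp hf φM
      posDef_h := fun _ hu => JetGravity.posDef_metricComp he hT hu
      posDef_φ := fun _ hy => JetGravity.posDef_metricComp hf φM hy
      smooth_X := JetGravity.contDiffOn_fieldComp he hf hX
      eq_sum := fun _ hz1 hz2 => JetGravity.leastSquares_jetPoint he hf hT φM XTM ⟨hz1, hz2⟩ }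
  refine ⟨fun z hz => ⟨S.verticalMetric_eq hz, S.hPotential_eq hp Γ hz, S.hPotential_symm hp Γ hz,
    fun v hv => S.hPotential_pos hp Γ hz hv⟩, ?_⟩
  intro K hK 𝒯 τ Einstein Sc
  have hE (z) (hz : z ∈ JetGravity.jetDomain e f) :=
    S.einstein_iff hp Γ hz hK (fun A B => τ A B z)
  refine ⟨hE, fun hEin z hz => ⟨?_, ?_⟩⟩
  · exact S.sum_berwaldT_eq_zero hK (τ := fun α β => τ (.inl α) (.inl β))
      (fun w hw => ((hE w hw).1 (hEin w hw)).1.1) hz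
  · exact S.sum_berwaldM_eq_zero hK (τ := fun i j => τ (.inr (.inl i)) (.inr (.inl j)))
      (fun w hw => ((hE w hw).1 (hEin w hw)).1.2.1) hz
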